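/- For a finite simple graph $G=(V,E)$, $p\in[0,1]$ and $q>0$, each $\omega\in\{0,1\}^E$ defines the graph $G(\omega)=(V,\{e\in E:\omega_e=1\})$; let $k(\omega)$ be its number of connected components. The random cluster measure is $\phi_{G,p,q}[\omega]=Z_{G,p,q}^{-1}\,q^{k(\omega)}\prod_{e\in E}p^{\omega_e}(1-p)^{1-\omega_e}$, where $Z_{G,p,q}=\sum_{\omega}q^{k(\omega)}\prod_{e\in E}p^{\omega_e}(1-p)^{1-\omega_e}$. For $\lambda>0$ let $\phi_{n,\lambda,q}$ and $Z_{n,\lambda,q}$ be these objects for the complete graph $K_n$ with $p=\lambda/n$ (defined for $n\ge\lambda$), and for an event $A$ write $Z_{n,\lambda,q}[A]=Z_{n,\lambda,q}\,\phi_{n,\lambda,q}[A]$. Let $L$ be the event that $K_n(\omega)$ is acyclic (a forest), and for an integer $r\ge1$ let $B_r$ be the event that $K_n(\omega)$ has no connected component with more than $r$ vertices. For $x>0$ put $\Psi(x)=\min\{\log x-\tfrac12(x-\tfrac1x),\,0\}$. **Theorem.** Fix $q>0$. For every $\lambda>0$ all the limits below exist and $$\lim_{n\to\infty}\frac1n\log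 Z_{n,\lambda,q}[L]=\lim_{r\to\infty}\lim_{n\to\infty}\frac1n\log Z_{n,\lambda,q}[B_r\cap L]=\Psi\!\left(\frac{\lambda}{q}\right)-\frac{q-1}{2q}\,\lambda+\log q .$$ Moreover, the convergence is uniform for $\lambda$ in compact subsets of $(0,\infty)\setminus\{q\}$: this holds for the limit $n\to\infty$ of $\frac1n\log Z_{n,\lambda,q}[L]$, for the limit $n\to\infty$ of $\frac1n\log Z_{n,\lambda,q}[B_r\cap L]$ for each fixed $r\ge1$, and for the subsequent limit $r\to\infty$. -/

import Mathlib

open Filter Topology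

noncomputable section

namespace RandomCluster

/-- The state space `{0,1}^E` of a graph `G = (V, E)`; the edge `e` is open in `ω` if
`ω e = true` and closed otherwise. -/
abbrev Config {V : Type*} (G : SimpleGraph V) : Type _ := G.edgeSet → Bool

/-- The spanning subgraph `G(ω)` whose edges are the open edges of `ω`. -/
def openGraph {V : Type*} (G : SimpleGraph V) (ω : Config G) : SimpleGraph V :=
  SimpleGraph.fromEdgeSet {e | ∃ h : e ∈ G.edgeSet, ω ⟨e, h⟩ = true}

/-- The number `k(ω)` of connected components of `G(ω)`. -/
def numComponents {V : Type*} (G : SimpleGraph V) (ω : Config G) : ℕ :=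
  Nat.card (openGraph G ω).ConnectedComponent

open Classical in
/-- The weight `(∏_e p^{ω_e} (1-p)^{1-ω_e}) q^{k(ω)}` of a configuration. -/
def weight {V : Type*} [Fintype V] (G : SimpleGraph V) (p q : ℝ) (ω : Config G) : ℝ :=
  (∏ e : G.edgeSet, if ω e = true then p else 1 - p) * q ^ numComponents G ω

open Classical in
/-- The partition function `Z_{G,p,q}`. -/
def partitionFunction {V : Type*} [Fintype V] (G : SimpleGraph V) (p q : ℝ) : ℝ :=
  ∑ ω : Config G, weight G p q ω

open Classical in
/-- The probability `φ_{G,p,q}[A]` of an event `A` in the random cluster model. -/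
def prob {V : Type*} [Fintype V] (G : SimpleGraph V) (p q : ℝ) (A : Set (Config G)) : ℝ :=
  ∑ ω : Config G with ω ∈ A, weight G p q ω / partitionFunction G p q

/-- The complete graph `K_n` on `n` vertices. -/
abbrev K (n : ℕ) : SimpleGraph (Fin n) := SimpleGraph.completeGraph (Fin n)

/-- `Z_{n,λ,q}[A] = Z_{n,λ,q} φ_{n,λ,q}[A]`, for the complete graph with edge weight `λ/n`. -/
def Z (n : ℕ) (lam q : ℝ) (A : Set (Config (K n))) : ℝ :=
  partitionFunction (K n) (lam / n) q * prob (K n) (lam / n) q A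

/-- The event `L` that the open graph is acyclic. -/
def L (n : ℕ) : Set (Config (K n)) :=
  {ω | (openGraph (K n) ω).IsAcyclic}

/-- The event `B_r` that there is no connected component with more than `r` vertices. -/
def B (n r : ℕ) : Set (Config (K n)) :=
  {ω | ∀ c : (openGraph (K n) ω).ConnectedComponent, c.supp.ncard ≤ r}

/-- `Ψ(x) = (log x - (x - 1/x)/2) ∧ 0`, for `x > 0`. -/
def Psi (x : ℝ) : ℝ := min (Real.log x - 1 / 2 * (x - 1 / x)) 0

/-- The limiting exponential rate `Ψ(λ/q) - ((q-1)/(2q)) λ + log q`. -/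
def acyclicRate (q lam : ℝ) : ℝ :=
  Psi (lam / q) - (q - 1) / (2 * q) * lam + Real.log q

end RandomCluster

end

/-!
The number of edges of a forest on `n` vertices is `n - k`, where `k` counts its components. Hence
`Z_{n,λ,q}[B_r ∩ L]` is an explicit factor times `forestSum r n N = ∑_F N ^ k(F)`, the sum over
forests with components of size at most `r`, at `N = q (n - λ) / λ` (`Z_eq`); no bound on the size
is `r = ⊤`. With `t = q / λ` it remains to find the growth rate `forestRate r t` of
`forestSum r n (t n) / n!`, a sequence that is supermultiplicative in `(n, N)` jointly, because
`(N + M) ^ k(F)` sums over the 2-colourings of the components of `F`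
(`choose_mul_forestSum_mul_forestSum_le`). This has three consequences.

* By Fekete's lemma the rate exists and equals a supremum over `n`. As a bound `r ≥ n` is void, the
  limit `r → ∞` is an exchange of suprema (`tendsto_forestRate_bound`).
* The rate is concave in `t` (`forestRate_concave`).
* The unbounded rate needs to be computed in one phase only. For `t > 1` it is
  `1 + log t + 1 / (2 t)`, because the subcritical Erdős–Rényi graph is a forest with probability
  bounded away from `0`; this holds by positive correlation of the absence of the various cycles
  (`exp_le_bernoulliProb_acyclic`). The upper bound `forestRate_le` holds for all `t`.

For `t < 1` the rate is `1 + t / 2`, that is, affine. The graph of the concave function lies below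
its tangent at `1`, which is the line `1 + t / 2`. It lies above the chord from `(1, 3 / 2)` to
`(0, 1)`, which is the same line, because the rate is at least `1` near `0`: there are at least
`n! e ^ (n (1 - o(1)))` forests on `n` vertices, as layered forests with layers of a large constant
size show (`factorial_mul_pow_le_forestSum`). Geometrically, a supercritical forest consists of a
giant tree and a critical remainder.

Uniformity on compact sets follows from monotonicity in `λ`: pointwise convergence of monotone
functions to a continuous limit is locally uniform (`tendstoLocallyUniformlyOn_of_antitoneOn`).
-/

noncomputable section

namespace RandomCluster

open SimpleGraph

/-! ### Forests and disjoint sums of graphs -/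

section Graph

variable {V W : Type*}

/-- In a forest, `|E| + k = |V|`: sum the degrees over each component, which is a tree. -/
theorem card_edgeSet_add_card_connectedComponent [Fintype V]
    {G : SimpleGraph V} (hG : G.IsAcyclic) :
    Nat.card G.edgeSet + Nat.card G.ConnectedComponent = Nat.card V := by
  classical
  have hdeg : ∀ (c : G.ConnectedComponent) (v : c), c.toSimpleGraph.degree v = G.degree v.1 := by
    intro c v
    rw [← card_neighborSet_eq_degree, ← card_neighborSet_eq_degree]
    refine Fintype.card_congr (Equiv.ofBijective
      (fun w => (⟨w.1.1, w.2⟩ : G.neighborSet v.1)) ⟨?_, ?_⟩)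
    · intro w w' h
      have h' : w.1.1 = w'.1.1 := by injection h
      exact Subtype.ext (Subtype.ext h')
    · rintro ⟨w, hw⟩
      have hwc : w ∈ c.supp := (c.mem_supp_congr_adj hw).1 v.2
      exact ⟨⟨⟨w, hwc⟩, hw⟩, rfl⟩
  have hcomp : ∀ c : G.ConnectedComponent,
      ∑ v : c, G.degree v.1 + 2 = 2 * Fintype.card c := by
    intro c
    have h1 := c.toSimpleGraph.sum_degrees_eq_twice_card_edges
    have h2 := (hG.isTree_connectedComponent c).card_edgeFinset
    have h3 : ∑ v : c, G.degree v.1 = ∑ v : c, c.toSimpleGraph.degree v :=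
      Finset.sum_congr rfl fun v _ => (hdeg c v).symm
    omega
  have hV : ∀ f : V → ℕ, ∑ v, f v = ∑ c : G.ConnectedComponent, ∑ v : c, f v.1 := by
    intro f
    rw [← (Equiv.sigmaFiberEquiv G.connectedComponentMk).sum_comp, Fintype.sum_sigma]
    rfl
  have h1 := G.sum_degrees_eq_twice_card_edges
  have h2 : ∑ v, G.degree v + 2 * Fintype.card G.ConnectedComponent = 2 * Fintype.card V := by
    have h3 : Fintype.card V = ∑ v : V, 1 := by simp
    rw [h3, hV, hV, Finset.mul_sum]
    simp only [Finset.sum_const, Finset.card_univ, smul_eq_mul, mul_one]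
    rw [← Finset.sum_congr rfl fun c _ => hcomp c, Finset.sum_add_distrib]
    simp [mul_comm]
  rw [Nat.card_eq_fintype_card, Nat.card_eq_fintype_card, Nat.card_eq_fintype_card,
    ← edgeFinset_card]
  omega

/-- A forest all of whose components have at most `r` vertices; `r = ⊤` imposes no bound. -/
def IsBoundedForest (r : ℕ∞) (G : SimpleGraph V) : Prop :=
  G.IsAcyclic ∧ ∀ c : G.ConnectedComponent, (c.supp.ncard : ℕ∞) ≤ r

/-- A graph is acyclic if it is so on both sides of a cut without edges. -/
theorem isAcyclic_of_disjoint_cover {G : SimpleGraph V} {s : Set V}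
    (hs : ∀ v w, G.Adj v w → v ∈ s → w ∈ s) (h1 : (G.induce s).IsAcyclic)
    (h2 : (G.induce sᶜ).IsAcyclic) : G.IsAcyclic := by
  have key : ∀ t : Set V, (∀ v w, G.Adj v w → v ∈ t → w ∈ t) → (G.induce t).IsAcyclic →
      ∀ v ∈ t, ∀ c : G.Walk v v, ¬ c.IsCycle := by
    intro t ht hA v hv c hc
    have hmem : ∀ (a b : V) (w : G.Walk a b), a ∈ t → ∀ x ∈ w.support, x ∈ t := by
      intro a b w
      induction w with
      | nil => intro ha x hx; simp at hx; exact hx ▸ ha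
      | cons hadj w ih =>
        intro ha x hx
        rw [Walk.support_cons, List.mem_cons] at hx
        rcases hx with rfl | hx
        · exact ha
        · exact ih (ht _ _ hadj ha) x hx
    have hm := hmem v v c hv
    refine hA (c.induce t hm) ?_
    have := Walk.map_induce c hm
    rw [← this] at hc
    exact (Walk.isCycle_map_iff_of_injective
      (Embedding.induce (G := G) t).injective).1 hc
  intro v c
  by_cases hv : v ∈ s
  · exact key s hs h1 v hv c
  · refine key sᶜ (fun v w hvw hv hw => hv (hs w v hvw.symm hw)) h2 v hv c

theorem isAcyclic_sum {G : SimpleGraph V} {H : SimpleGraph W} (hG : G.IsAcyclic)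
    (hH : H.IsAcyclic) : (G ⊕g H).IsAcyclic := by
  refine isAcyclic_of_disjoint_cover (s := Set.range Sum.inl) ?_ ?_ ?_
  · rintro (v | v) (w | w) h hv <;> simp_all
  · exact (Embedding.isoInduceRange (Embedding.sumInl (G := G) (H := H))).isAcyclic_iff.1 hG
  · have : (Set.range Sum.inl : Set (V ⊕ W))ᶜ = Set.range Sum.inr := Set.compl_range_inl
    rw [this]
    exact (Embedding.isoInduceRange (Embedding.sumInr (G := G) (H := H))).isAcyclic_iff.1 hH

theorem sum_map_mk_eq_of_reachable {G : SimpleGraph V} {H : SimpleGraph W} {x y : V ⊕ W}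
    (h : (G ⊕g H).Reachable x y) :
    Sum.map G.connectedComponentMk H.connectedComponentMk x =
      Sum.map G.connectedComponentMk H.connectedComponentMk y := by
  obtain ⟨w⟩ := h
  induction w with
  | nil => rfl
  | @cons a b c hab w ih =>
    rw [← ih]
    rcases a with a | a <;> rcases b with b | b
    · exact congrArg Sum.inl
        (ConnectedComponent.connectedComponentMk_eq_of_adj (by simpa using hab))
    · simp at hab
    · simp at hab
    · exact congrArg Sum.inr
        (ConnectedComponent.connectedComponentMk_eq_of_adj (by simpa using hab))

/-- The components of a disjoint sum of graphs are the components of the summands. -/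
def componentSumEquiv (G : SimpleGraph V) (H : SimpleGraph W) :
    (G ⊕g H).ConnectedComponent ≃ G.ConnectedComponent ⊕ H.ConnectedComponent where
  toFun := ConnectedComponent.lift
    (Sum.map G.connectedComponentMk H.connectedComponentMk)
    fun _ _ p _ => sum_map_mk_eq_of_reachable ⟨p⟩
  invFun := Sum.elim (ConnectedComponent.map Embedding.sumInl.toHom)
    (ConnectedComponent.map Embedding.sumInr.toHom)
  left_inv c := by
    induction c using ConnectedComponent.ind with
    | h v => rcases v with v | v <;> rfl
  right_inv c := by
    rcases c with c | c <;> induction c using ConnectedComponent.ind <;> rfl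

end Graph

/-! ### Supermultiplicativity of the forest polynomial -/

open Classical in
/-- The generating polynomial `∑_F N ^ k(F)` of the forests on `n` labelled vertices with
components of size at most `r`, counted by their number `k(F)` of components. -/
def forestSum (r : ℕ∞) (n : ℕ) (N : ℝ) : ℝ :=
  ∑ F : SimpleGraph (Fin n) with IsBoundedForest r F, N ^ Nat.card F.ConnectedComponent

theorem sum_le_sum_of_injOn {ι κ : Type*} {s : Finset ι} {t : Finset κ}
    {f : ι → ℝ} {g : κ → ℝ} (φ : ι → κ) (hφ : ∀ i ∈ s, φ i ∈ t) (hinj : Set.InjOn φ s)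
    (hfg : ∀ i ∈ s, f i ≤ g (φ i)) (hg : ∀ j ∈ t, 0 ≤ g j) :
    ∑ i ∈ s, f i ≤ ∑ j ∈ t, g j := by
  classical
  calc ∑ i ∈ s, f i ≤ ∑ i ∈ s, g (φ i) := Finset.sum_le_sum hfg
    _ = ∑ j ∈ s.image φ, g j := (Finset.sum_image hinj).symm
    _ ≤ ∑ j ∈ t, g j := Finset.sum_le_sum_of_subset_of_nonneg
        (Finset.image_subset_iff.2 hφ) fun j hj _ => hg j hj

section Join

variable {V W U : Type*}

/-- The disjoint union of two graphs, transported along a bijection of vertex sets. -/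
def join (e : V ⊕ W ≃ U) (G : SimpleGraph V) (H : SimpleGraph W) : SimpleGraph U :=
  (G ⊕g H).comap e.symm

/-- `join e G H` is a relabelling of the disjoint sum of `G` and `H`. -/
def joinIso (e : V ⊕ W ≃ U) (G : SimpleGraph V) (H : SimpleGraph W) :
    join e G H ≃g G ⊕g H :=
  Iso.comap e.symm _

theorem join_adj_inl {e : V ⊕ W ≃ U} {G : SimpleGraph V} {H : SimpleGraph W} {v w : V} :
    (join e G H).Adj (e (Sum.inl v)) (e (Sum.inl w)) ↔ G.Adj v w := by
  simp [join]

theorem join_adj_inr {e : V ⊕ W ≃ U} {G : SimpleGraph V} {H : SimpleGraph W} {v w : W} :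
    (join e G H).Adj (e (Sum.inr v)) (e (Sum.inr w)) ↔ H.Adj v w := by
  simp [join]

theorem join_injective (e : V ⊕ W ≃ U) :
    Function.Injective fun x : SimpleGraph V × SimpleGraph W => join e x.1 x.2 := by
  rintro ⟨G, H⟩ ⟨G', H'⟩ h
  simp only at h
  refine Prod.ext ?_ ?_
  · ext v w
    simp only
    rw [← join_adj_inl (e := e) (H := H), h, join_adj_inl]
  · ext v w
    simp only
    rw [← join_adj_inr (e := e) (G := G), h, join_adj_inr]

/-- The components of `join e G H` are those of `G` and those of `H`. -/
def joinComponentEquiv (e : V ⊕ W ≃ U) (G : SimpleGraph V) (H : SimpleGraph W) :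
    (join e G H).ConnectedComponent ≃ G.ConnectedComponent ⊕ H.ConnectedComponent :=
  (joinIso e G H).connectedComponentEquiv.trans (componentSumEquiv G H)

theorem joinComponentEquiv_mk (e : V ⊕ W ≃ U) (G : SimpleGraph V) (H : SimpleGraph W) (x : V ⊕ W) :
    joinComponentEquiv e G H ((join e G H).connectedComponentMk (e x)) =
      Sum.map G.connectedComponentMk H.connectedComponentMk x := by
  change Sum.map G.connectedComponentMk H.connectedComponentMk (e.symm (e x)) = _
  rw [e.symm_apply_apply]

theorem supp_join_inl (e : V ⊕ W ≃ U) (G : SimpleGraph V) (H : SimpleGraph W)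
    (c : G.ConnectedComponent) :
    ((joinComponentEquiv e G H).symm (Sum.inl c)).supp = (fun v => e (Sum.inl v)) '' c.supp := by
  ext u
  obtain ⟨x, rfl⟩ := e.surjective u
  rw [ConnectedComponent.mem_supp_iff, Equiv.eq_symm_apply, joinComponentEquiv_mk]
  rcases x with x | x <;> simp

theorem supp_join_inr (e : V ⊕ W ≃ U) (G : SimpleGraph V) (H : SimpleGraph W)
    (c : H.ConnectedComponent) :
    ((joinComponentEquiv e G H).symm (Sum.inr c)).supp = (fun v => e (Sum.inr v)) '' c.supp := by
  ext u
  obtain ⟨x, rfl⟩ := e.surjective u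
  rw [ConnectedComponent.mem_supp_iff, Equiv.eq_symm_apply, joinComponentEquiv_mk]
  rcases x with x | x <;> simp

theorem IsBoundedForest.join {r : ℕ∞} {G : SimpleGraph V} {H : SimpleGraph W}
    (hG : IsBoundedForest r G) (hH : IsBoundedForest r H) (e : V ⊕ W ≃ U) :
    IsBoundedForest r (join e G H) := by
  refine ⟨(joinIso e G H).isAcyclic_iff.2 (isAcyclic_sum hG.1 hH.1), fun c => ?_⟩
  obtain ⟨d, rfl⟩ := (joinComponentEquiv e G H).symm.surjective c
  rcases d with d | d
  · rw [supp_join_inl, Set.ncard_image_of_injective (f := fun v => e (Sum.inl v)) _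
      (e.injective.comp Sum.inl_injective)]
    exact hG.2 d
  · rw [supp_join_inr, Set.ncard_image_of_injective (f := fun v => e (Sum.inr v)) _
      (e.injective.comp Sum.inr_injective)]
    exact hH.2 d

theorem natCard_component_join [Finite V] [Finite W] (e : V ⊕ W ≃ U) (G : SimpleGraph V)
    (H : SimpleGraph W) :
    Nat.card (join e G H).ConnectedComponent =
      Nat.card G.ConnectedComponent + Nat.card H.ConnectedComponent := by
  rw [Nat.card_congr (joinComponentEquiv e G H), Nat.card_sum]

/-- The components of `G` contained in `S`. -/
def componentsIn (G : SimpleGraph U) (S : Set U) : Set G.ConnectedComponent :=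
  {c | c.supp ⊆ S}

theorem ncard_componentsIn_join [Finite V] [Finite W] (e : V ⊕ W ≃ U) (G : SimpleGraph V)
    (H : SimpleGraph W) {S : Set U} (hl : ∀ v, e (Sum.inl v) ∈ S) (hr : ∀ w, e (Sum.inr w) ∉ S) :
    (componentsIn (join e G H) S).ncard = Nat.card G.ConnectedComponent := by
  have : componentsIn (join e G H) S =
      Set.range fun c => (joinComponentEquiv e G H).symm (Sum.inl c) := by
    ext d
    obtain ⟨d, rfl⟩ := (joinComponentEquiv e G H).symm.surjective d
    rcases d with d | d
    · simp only [componentsIn, Set.mem_ofPred_eq, supp_join_inl, Set.mem_range,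
        EmbeddingLike.apply_eq_iff_eq, Sum.inl.injEq, exists_eq, iff_true]
      rintro _ ⟨v, _, rfl⟩
      exact hl v
    · simp only [componentsIn, Set.mem_ofPred_eq, supp_join_inr, Set.mem_range,
        EmbeddingLike.apply_eq_iff_eq, reduceCtorEq, exists_false, iff_false]
      intro h
      obtain ⟨w, hw⟩ := d.nonempty_supp
      exact hr w (h ⟨w, hw, rfl⟩)
  rw [this, ← Set.image_univ, Set.ncard_image_of_injective, Set.ncard_univ]
  exact (joinComponentEquiv e G H).symm.injective.comp Sum.inl_injective

theorem join_closed (e : V ⊕ W ≃ U) (G : SimpleGraph V) (H : SimpleGraph W) {S : Set U}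
    (hl : ∀ v, e (Sum.inl v) ∈ S) (hr : ∀ w, e (Sum.inr w) ∉ S) :
    ∀ u u', (join e G H).Adj u u' → u ∈ S → u' ∈ S := by
  intro u u' h hu
  obtain ⟨x, rfl⟩ := e.surjective u
  obtain ⟨y, rfl⟩ := e.surjective u'
  rcases x with x | x <;> rcases y with y | y
  · exact hl y
  · simp [join] at h
  · exact absurd hu (hr x)
  · exact absurd hu (hr x)

/-- A union of components is determined by the components that it contains. -/
theorem mem_iff_mem_componentsIn {G : SimpleGraph U} {S : Set U}
    (hS : ∀ u u', G.Adj u u' → u ∈ S → u' ∈ S) (u : U) :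
    u ∈ S ↔ G.connectedComponentMk u ∈ componentsIn G S := by
  constructor
  · intro hu v hv
    have hr : G.Reachable u v := (ConnectedComponent.exact hv).symm
    obtain ⟨w⟩ := hr
    clear hv
    induction w with
    | nil => exact hu
    | cons h w ih => exact ih (hS _ _ h hu)
  · intro h
    exact h rfl

end Join

open Classical in
/-- Supermultiplicativity of `forestSum`. By the binomial theorem, `(N + M) ^ k(F)` is a sum over
the 2-colourings of the components of `F`; the left side collects the colourings in which exactly
`n` vertices have the first colour. -/
theorem choose_mul_forestSum_mul_forestSum_le (r : ℕ∞) (n m : ℕ) {N M : ℝ}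
    (hN : 0 ≤ N) (hM : 0 ≤ M) :
    ((n + m).choose n : ℝ) * (forestSum r n N * forestSum r m M) ≤
      forestSum r (n + m) (N + M) := by
  -- for `#S = n`, a labelling of `S` by `Fin n` and of its complement by `Fin m`
  have hex : ∀ S : Finset (Fin (n + m)), ∃ e : Fin n ⊕ Fin m ≃ Fin (n + m),
      S.card = n → (∀ v, e (Sum.inl v) ∈ (S : Set (Fin (n + m)))) ∧
        ∀ w, e (Sum.inr w) ∉ (S : Set (Fin (n + m))) := by
    intro S
    by_cases hS : S.card = n
    · have hSc : Sᶜ.card = m := by rw [Finset.card_compl, hS, Fintype.card_fin]; omega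
      refine ⟨finSumEquivOfFinset hS hSc, fun _ => ⟨fun v => ?_, fun w => ?_⟩⟩
      · rw [finSumEquivOfFinset_inl]
        exact Finset.orderEmbOfFin_mem _ _ _
      · rw [finSumEquivOfFinset_inr]
        exact Finset.mem_compl.1 (Finset.orderEmbOfFin_mem Sᶜ hSc w)
    · exact ⟨finSumFinEquiv, fun h => absurd h hS⟩
  choose e he using hex
  let F (k : ℕ) : Finset (SimpleGraph (Fin k)) := Finset.univ.filter (IsBoundedForest r)
  let w (G : SimpleGraph (Fin (n + m))) (S : Finset (Fin (n + m))) : ℝ :=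
    N ^ (componentsIn G S).ncard *
      M ^ (Nat.card G.ConnectedComponent - (componentsIn G S).ncard)
  have hw : ∀ G S, 0 ≤ w G S := fun G S => by positivity
  let closed (G : SimpleGraph (Fin (n + m))) (S : Finset (Fin (n + m))) : Prop :=
    ∀ u u', G.Adj u u' → u ∈ (S : Set (Fin (n + m))) → u' ∈ (S : Set (Fin (n + m)))
  calc ((n + m).choose n : ℝ) * (forestSum r n N * forestSum r m M)
      = ∑ S ∈ Finset.powersetCard n (Finset.univ : Finset (Fin (n + m))),
          forestSum r n N * forestSum r m M := by
        rw [Finset.sum_const, Finset.card_powersetCard, Finset.card_univ, Fintype.card_fin,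
          nsmul_eq_mul]
    _ ≤ ∑ S ∈ Finset.powersetCard n (Finset.univ : Finset (Fin (n + m))),
          ∑ G ∈ F (n + m) with closed G S, w G S := by
        refine Finset.sum_le_sum fun S hS => ?_
        obtain ⟨hl, hr⟩ := he S (Finset.mem_powersetCard.1 hS).2
        rw [forestSum, forestSum, Finset.sum_mul_sum, ← Finset.sum_product']
        refine sum_le_sum_of_injOn (fun x => join (e S) x.1 x.2) ?_
          (join_injective (e S)).injOn ?_ fun _ _ => hw _ _
        · rintro ⟨G, H⟩ hGH
          simp only [Finset.mem_product, Finset.mem_filter, Finset.mem_univ, true_and] at hGH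
          simp only [F, Finset.mem_filter, Finset.mem_univ, true_and]
          exact ⟨hGH.1.join hGH.2 _, join_closed _ _ _ hl hr⟩
        · rintro ⟨G, H⟩ -
          simp only [w]
          rw [ncard_componentsIn_join _ _ _ hl hr, natCard_component_join, Nat.add_sub_cancel_left]
    _ ≤ ∑ S : Finset (Fin (n + m)), ∑ G ∈ F (n + m) with closed G S, w G S :=
        Finset.sum_le_sum_of_subset_of_nonneg (Finset.subset_univ _)
          fun S _ _ => Finset.sum_nonneg fun G _ => hw G S
    _ = ∑ G ∈ F (n + m), ∑ S : Finset (Fin (n + m)) with closed G S, w G S := by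
        simp only [Finset.sum_filter]
        exact Finset.sum_comm
    _ ≤ forestSum r (n + m) (N + M) := by
        refine Finset.sum_le_sum fun G _ => ?_
        rw [Nat.card_eq_fintype_card, ← Fintype.sum_pow_mul_eq_add_pow]
        refine sum_le_sum_of_injOn (fun S => (componentsIn G S).toFinset)
          (fun _ _ => Finset.mem_univ _) ?_ ?_ fun _ _ => by positivity
        · intro S hS T hT hST
          simp only [Finset.coe_filter, Finset.mem_univ, true_and, Set.mem_ofPred_eq] at hS hT
          have hST' : componentsIn G S = componentsIn G T := Set.toFinset_inj.1 hST
          ext u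
          rw [← Finset.mem_coe, ← Finset.mem_coe, mem_iff_mem_componentsIn hS,
            mem_iff_mem_componentsIn hT, hST']
        · intro S _
          simp only [w]
          rw [Set.ncard_eq_toFinset_card', Nat.card_eq_fintype_card]

/-! ### The partition function as a forest polynomial -/

theorem isBoundedForest_bot {V : Type*} {r : ℕ∞} (hr : 1 ≤ r) :
    IsBoundedForest r (⊥ : SimpleGraph V) := by
  refine ⟨isAcyclic_bot, fun c => le_trans ?_ hr⟩
  have : c.supp.Subsingleton := by
    intro v hv w hw
    have : (⊥ : SimpleGraph V).Reachable v w := ConnectedComponent.exact (hv.trans hw.symm)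
    exact reachable_bot.1 this
  have := this.finite.to_subtype
  have h1 : c.supp.ncard ≤ 1 := Set.ncard_le_one_iff_subsingleton.2 ‹_›
  exact_mod_cast h1

theorem forestSum_pos {r : ℕ∞} (hr : 1 ≤ r) (n : ℕ) {N : ℝ} (hN : 0 < N) : 0 < forestSum r n N := by
  classical
  exact Finset.sum_pos (fun _ _ => by positivity)
    ⟨⊥, Finset.mem_filter.2 ⟨Finset.mem_univ _, isBoundedForest_bot hr⟩⟩

theorem forestSum_mono (r : ℕ∞) (n : ℕ) {N M : ℝ} (hN : 0 ≤ N) (hNM : N ≤ M) :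
    forestSum r n N ≤ forestSum r n M := by
  classical
  exact Finset.sum_le_sum fun _ _ => by gcongr

theorem forestSum_mono_bound {r s : ℕ∞} (hrs : r ≤ s) (n : ℕ) {N : ℝ} (hN : 0 ≤ N) :
    forestSum r n N ≤ forestSum s n N := by
  classical
  refine Finset.sum_le_sum_of_subset_of_nonneg (fun G hG => ?_) fun _ _ _ => by positivity
  simp only [Finset.mem_filter, Finset.mem_univ, true_and] at hG ⊢
  exact ⟨hG.1, fun c => (hG.2 c).trans hrs⟩

theorem natCard_component_le {V : Type*} [Finite V] (G : SimpleGraph V) :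
    Nat.card G.ConnectedComponent ≤ Nat.card V :=
  Nat.card_le_card_of_surjective G.connectedComponentMk Quot.mk_surjective

/-- A bound on the component sizes beyond the number of vertices is void. -/
theorem forestSum_eq_top {r : ℕ∞} {n : ℕ} (h : (n : ℕ∞) ≤ r) (N : ℝ) :
    forestSum r n N = forestSum ⊤ n N := by
  classical
  refine Finset.sum_congr (Finset.filter_congr fun G _ => ?_) fun _ _ => rfl
  refine and_congr_right fun _ => iff_of_true (fun c => le_trans ?_ h) fun c => le_top
  have := Set.ncard_le_card c.supp
  rw [Nat.card_fin] at this
  exact_mod_cast this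

/-- `forestSum r n N / N ^ n` is antitone in `N`, a forest having at most `n` components. -/
theorem forestSum_le_pow_mul (r : ℕ∞) (n : ℕ) {N M : ℝ} (hN : 0 < N) (hNM : N ≤ M) :
    forestSum r n M ≤ (M / N) ^ n * forestSum r n N := by
  classical
  rw [forestSum, forestSum, Finset.mul_sum]
  refine Finset.sum_le_sum fun G _ => ?_
  have h : Nat.card G.ConnectedComponent ≤ n := by
    simpa using natCard_component_le G
  calc M ^ Nat.card G.ConnectedComponent
      = (M / N) ^ Nat.card G.ConnectedComponent * N ^ Nat.card G.ConnectedComponent := by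
        rw [← mul_pow, div_mul_cancel₀ _ hN.ne']
    _ ≤ _ := by
        gcongr
        rwa [one_le_div hN]

theorem edgeSet_openGraph {V : Type*} (G : SimpleGraph V) (ω : Config G) :
    (openGraph G ω).edgeSet = {e | ∃ h : e ∈ G.edgeSet, ω ⟨e, h⟩ = true} := by
  rw [openGraph, edgeSet_fromEdgeSet, sdiff_eq_left, Set.disjoint_left]
  rintro e ⟨h, -⟩
  exact G.not_isDiag_of_mem_edgeSet h

theorem openGraph_bijective (n : ℕ) : Function.Bijective (openGraph (K n)) := by
  classical
  constructor
  · intro ω ω' h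
    have h' := congrArg edgeSet h
    rw [edgeSet_openGraph, edgeSet_openGraph] at h'
    funext e
    have := Set.ext_iff.1 h' e.1
    simp only [Set.mem_ofPred_eq, e.2, exists_true_left] at this
    exact Bool.eq_iff_iff.2 this
  · intro G
    refine ⟨fun e => decide (e.1 ∈ G.edgeSet), ?_⟩
    rw [← edgeSet_inj, edgeSet_openGraph]
    ext e
    simp only [Set.mem_ofPred_eq, decide_eq_true_eq, exists_prop, and_iff_right_iff_imp]
    intro he
    exact edgeSet_mono (le_top : G ≤ ⊤) he

open Classical in
theorem card_open_edges {V : Type*} [Fintype V] (G : SimpleGraph V) (ω : Config G) :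
    (Finset.univ.filter fun e => ω e = true).card = Nat.card (openGraph G ω).edgeSet := by
  rw [edgeSet_openGraph, ← Fintype.card_subtype, ← Nat.card_eq_fintype_card]
  refine Nat.card_congr ⟨fun e => ⟨e.1.1, e.1.2, e.2⟩, fun e => ⟨⟨e.1, e.2.1⟩, e.2.2⟩,
    fun _ => rfl, fun _ => rfl⟩

theorem card_edgeSet_K (n : ℕ) : Nat.card (K n).edgeSet = n.choose 2 := by
  classical
  have h := card_edgeFinset_top_eq_card_choose_two (V := Fin n)
  rw [Fintype.card_fin] at h
  rw [← h, Nat.card_eq_fintype_card, edgeFinset_card]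

open Classical in
theorem prod_edge_weight {V : Type*} [Fintype V] (G : SimpleGraph V) (p : ℝ) (ω : Config G) :
    (∏ e : G.edgeSet, if ω e = true then p else 1 - p) =
      p ^ Nat.card (openGraph G ω).edgeSet *
        (1 - p) ^ (Nat.card G.edgeSet - Nat.card (openGraph G ω).edgeSet) := by
  rw [Finset.prod_ite, Finset.prod_const, Finset.prod_const, card_open_edges, Finset.filter_not,
    Finset.card_sdiff_of_subset (Finset.filter_subset _ _), card_open_edges, Finset.card_univ,
    Nat.card_eq_fintype_card (α := G.edgeSet)]

theorem weight_of_isAcyclic {n : ℕ} {p q : ℝ} (hp : 0 < p) (hp1 : p < 1) (hq : 0 < q)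
    {ω : Config (K n)} (hω : (openGraph (K n) ω).IsAcyclic) :
    weight (K n) p q ω = (1 - p) ^ n.choose 2 * (p / (1 - p)) ^ n *
      (q * (1 - p) / p) ^ Nat.card (openGraph (K n) ω).ConnectedComponent := by
  have h1 := card_edgeSet_add_card_connectedComponent hω
  rw [Nat.card_fin] at h1
  have h2 : Nat.card (openGraph (K n) ω).edgeSet ≤ n.choose 2 := by
    rw [← card_edgeSet_K]
    exact Nat.card_mono (Set.toFinite _) (edgeSet_mono le_top)
  rw [weight, prod_edge_weight, card_edgeSet_K, numComponents]
  generalize Nat.card (openGraph (K n) ω).edgeSet = m at *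
  generalize Nat.card (openGraph (K n) ω).ConnectedComponent = c at *
  obtain ⟨k, hk⟩ := Nat.exists_eq_add_of_le h2
  rw [hk, Nat.add_sub_cancel_left, ← h1]
  have : (1 - p) ≠ 0 := by linarith
  simp only [div_pow, mul_pow, pow_add]
  field_simp

theorem partitionFunction_pos {V : Type*} [Fintype V] (G : SimpleGraph V) {p q : ℝ}
    (hp : 0 < p) (hp1 : p < 1) (hq : 0 < q) : 0 < partitionFunction G p q := by
  classical
  refine Finset.sum_pos (fun ω _ => ?_) Finset.univ_nonempty
  refine mul_pos (Finset.prod_pos fun e _ => ?_) (by positivity)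
  split_ifs <;> linarith

open Classical in
theorem sum_weight_boundedForest {n : ℕ} {p q : ℝ} (hp : 0 < p) (hp1 : p < 1) (hq : 0 < q)
    (r : ℕ∞) :
    ∑ ω : Config (K n) with IsBoundedForest r (openGraph (K n) ω), weight (K n) p q ω =
      (1 - p) ^ n.choose 2 * (p / (1 - p)) ^ n * forestSum r n (q * (1 - p) / p) := by
  rw [forestSum, Finset.mul_sum, Finset.sum_filter, Finset.sum_filter]
  refine Fintype.sum_bijective _ (openGraph_bijective n) _ _ fun ω => ?_
  split_ifs with h
  · exact weight_of_isAcyclic hp hp1 hq h.1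
  · rfl

/-- The partition function restricted to bounded forests, in terms of `forestSum`: each edge beyond
the common factor `(1 - p) ^ E` costs `p / (1 - p)`, and the edges number `n - k`. -/
theorem Z_eq {n : ℕ} {lam q : ℝ} (hlam : 0 < lam) (hn : lam < n) (hq : 0 < q)
    {A : Set (Config (K n))} {r : ℕ∞}
    (hA : A = {ω | IsBoundedForest r (openGraph (K n) ω)}) :
    Z n lam q A = (1 - lam / n) ^ n.choose 2 * (lam / (n - lam)) ^ n *
      forestSum r n (q * (n - lam) / lam) := by
  classical
  have hn0 : (0 : ℝ) < n := hlam.trans hn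
  have hp : 0 < lam / n := by positivity
  have hp1 : lam / n < 1 := (div_lt_one hn0).2 hn
  have hnl : (n : ℝ) - lam ≠ 0 := by linarith
  have h := sum_weight_boundedForest (n := n) hp hp1 hq r
  have e1 : lam / n / (1 - lam / n) = lam / (n - lam) := by field_simp
  have e2 : q * (1 - lam / n) / (lam / n) = q * (n - lam) / lam := by field_simp
  rw [e1, e2] at h
  rw [Z, prob, ← h, ← Finset.sum_div,
    mul_div_cancel₀ _ (partitionFunction_pos (K n) hp hp1 hq).ne', hA]
  congr!

theorem L_eq (n : ℕ) : L n = {ω | IsBoundedForest ⊤ (openGraph (K n) ω)} := by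
  ext ω
  simp [L, IsBoundedForest]

theorem B_inter_L_eq (n r : ℕ) :
    B n r ∩ L n = {ω | IsBoundedForest (r : ℕ∞) (openGraph (K n) ω)} := by
  ext ω
  constructor
  · exact fun h => ⟨h.2, fun c => by exact_mod_cast h.1 c⟩
  · exact fun h => ⟨fun c => by exact_mod_cast h.2 c, h.1⟩

/-! ### Independent edges and the subcritical phase -/

section Bernoulli

variable {E : Type*} [Fintype E]

/-- The weight of `ω` under independent edges, each open with probability `p`. -/
def bernoulliWeight (p : ℝ) (ω : E → Bool) : ℝ := ∏ e, if ω e = true then p else 1 - p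

theorem bernoulliWeight_nonneg {p : ℝ} (hp : 0 ≤ p) (hp1 : p ≤ 1) (ω : E → Bool) :
    0 ≤ bernoulliWeight p ω :=
  Finset.prod_nonneg fun e _ => by split_ifs <;> linarith

theorem bernoulliWeight_mul (p : ℝ) (a b : E → Bool) :
    bernoulliWeight p a * bernoulliWeight p b =
      bernoulliWeight p (a ⊓ b) * bernoulliWeight p (a ⊔ b) := by
  simp only [bernoulliWeight, ← Finset.prod_mul_distrib]
  refine Finset.prod_congr rfl fun e _ => ?_
  cases ha : a e <;> cases hb : b e <;> simp [ha, hb, mul_comm]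

variable [DecidableEq E]

/-- The probability of `A` under independent edges, each open with probability `p`. -/
def bernoulliProb (p : ℝ) (A : Set (E → Bool)) : ℝ := ∑ ω, A.indicator (bernoulliWeight p) ω

theorem bernoulliProb_mono {p : ℝ} (hp : 0 ≤ p) (hp1 : p ≤ 1) {A B : Set (E → Bool)}
    (h : A ⊆ B) : bernoulliProb p A ≤ bernoulliProb p B :=
  Finset.sum_le_sum fun ω _ =>
    Set.indicator_le_indicator_of_subset h (bernoulliWeight_nonneg hp hp1) ω

theorem bernoulliProb_forall_open (p : ℝ) (D : Finset E) :
    bernoulliProb p {ω : E → Bool | ∀ e ∈ D, ω e = true} = p ^ D.card := by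
  have h : ∀ ω : E → Bool,
      Set.indicator {ω : E → Bool | ∀ e ∈ D, ω e = true} (bernoulliWeight p) ω =
      ∏ e, if ω e = true then p else if e ∈ D then 0 else 1 - p := by
    intro ω
    by_cases hω : ω ∈ {ω : E → Bool | ∀ e ∈ D, ω e = true}
    · rw [Set.indicator_of_mem hω]
      refine Finset.prod_congr rfl fun e _ => ?_
      by_cases he : ω e = true
      · simp [he]
      · have : e ∉ D := fun h => he (hω e h)
        simp [he, this]
    · rw [Set.indicator_of_notMem hω]
      simp only [Set.mem_ofPred_eq] at hω
      push Not at hω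
      obtain ⟨e, heD, he⟩ := hω
      refine (Finset.prod_eq_zero (Finset.mem_univ e) ?_).symm
      simp [heD, he]
  have h2 : ∀ e : E, ∑ b : Bool, (if b = true then p else if e ∈ D then 0 else 1 - p) =
      if e ∈ D then p else 1 := by
    intro e
    rw [Fintype.sum_bool]
    split_ifs <;> simp_all
  have h3 := Finset.prod_univ_sum (fun _ : E => (Finset.univ : Finset Bool))
    fun e b => if b = true then p else if e ∈ D then 0 else 1 - p
  rw [bernoulliProb, Finset.sum_congr rfl fun ω _ => h ω, ← Fintype.piFinset_univ, ← h3,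
    Finset.prod_congr rfl fun e _ => h2 e, Finset.prod_ite_mem, Finset.univ_inter,
    Finset.prod_const]

theorem bernoulliProb_univ (p : ℝ) : bernoulliProb p (Set.univ : Set (E → Bool)) = 1 := by
  simpa using bernoulliProb_forall_open (E := E) p ∅

theorem bernoulliProb_le_one {p : ℝ} (hp : 0 ≤ p) (hp1 : p ≤ 1) (A : Set (E → Bool)) :
    bernoulliProb p A ≤ 1 :=
  (bernoulliProb_mono hp hp1 (Set.subset_univ A)).trans_eq (bernoulliProb_univ p)

theorem bernoulliProb_compl (p : ℝ) (A : Set (E → Bool)) :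
    bernoulliProb p Aᶜ = 1 - bernoulliProb p A := by
  rw [eq_sub_iff_add_eq', ← bernoulliProb_univ (E := E) p, bernoulliProb, bernoulliProb,
    ← Finset.sum_add_distrib, bernoulliProb]
  refine Finset.sum_congr rfl fun ω _ => ?_
  rw [Set.indicator_univ, Set.indicator_self_add_compl_apply]

/-- Decreasing events are positively correlated. -/
theorem bernoulliProb_mul_le_inter {p : ℝ} (hp : 0 ≤ p) (hp1 : p ≤ 1)
    {A B : Set (E → Bool)} (hA : IsLowerSet A) (hB : IsLowerSet B) :
    bernoulliProb p A * bernoulliProb p B ≤ bernoulliProb p (A ∩ B) := by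
  have hw := bernoulliWeight_nonneg (E := E) hp hp1
  have hnn : ∀ S : Set (E → Bool), 0 ≤ S.indicator (bernoulliWeight p) :=
    fun S => Set.indicator_nonneg fun ω _ => hw ω
  have key := four_functions_theorem_univ (A.indicator (bernoulliWeight p))
    (B.indicator (bernoulliWeight p)) ((A ∩ B).indicator (bernoulliWeight p))
    (bernoulliWeight p) (hnn A) (hnn B) (hnn _) hw ?_
  · have h1 := bernoulliProb_univ (E := E) p
    rw [bernoulliProb, Set.indicator_univ] at h1
    rwa [h1, mul_one] at key
  · intro a b
    by_cases ha : a ∈ A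
    · by_cases hb : b ∈ B
      · have : a ⊓ b ∈ A ∩ B := ⟨hA inf_le_left ha, hB inf_le_right hb⟩
        rw [Set.indicator_of_mem ha, Set.indicator_of_mem hb, Set.indicator_of_mem this]
        exact (bernoulliWeight_mul p a b).le
      · rw [Set.indicator_of_notMem hb, mul_zero]
        exact mul_nonneg (hnn _ _) (hw _)
    · rw [Set.indicator_of_notMem ha, zero_mul]
      exact mul_nonneg (hnn _ _) (hw _)

/-- The probability that none of the edge sets `D i` is entirely open is at least what it would
be if these events were independent. -/
theorem prod_le_bernoulliProb {ι : Type*} {p : ℝ} (hp : 0 ≤ p) (hp1 : p ≤ 1)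
    (s : Finset ι) (D : ι → Finset E) :
    ∏ i ∈ s, (1 - p ^ (D i).card) ≤
      bernoulliProb p {ω : E → Bool | ∀ i ∈ s, ¬ ∀ e ∈ D i, ω e = true} := by
  classical
  have hlow : ∀ i, IsLowerSet ({ω : E → Bool | ∀ e ∈ D i, ω e = true}ᶜ) := by
    intro i a b hba ha hb
    exact ha fun e he => Bool.eq_true_of_true_le ((hb e he) ▸ hba e)
  induction s using Finset.induction_on with
  | empty => simpa using (bernoulliProb_univ (E := E) p).ge
  | insert i s hi ih =>
    rw [Finset.prod_insert hi]
    have hlow' : IsLowerSet {ω : E → Bool | ∀ i ∈ s, ¬ ∀ e ∈ D i, ω e = true} :=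
      fun a b hba ha j hj => hlow j hba (ha j hj)
    have := bernoulliProb_mul_le_inter hp hp1 (hlow i) hlow'
    rw [bernoulliProb_compl, bernoulliProb_forall_open] at this
    refine (mul_le_mul_of_nonneg_left ih ?_).trans (this.trans_eq ?_)
    · exact sub_nonneg.2 (pow_le_one₀ hp hp1)
    · congr 1
      ext ω
      simp

end Bernoulli

/-- The probability that the Erdős–Rényi graph is a forest, in terms of `forestSum`. -/
theorem bernoulliProb_acyclic (n : ℕ) {N : ℝ} (hN : 0 < N) :
    bernoulliProb (1 / (1 + N)) (L n) =
      (1 - 1 / (1 + N)) ^ n.choose 2 * (1 / N) ^ n * forestSum ⊤ n N := by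
  classical
  have hp : 0 < 1 / (1 + N) := by positivity
  have hp1 : 1 / (1 + N) < 1 := by rw [div_lt_one] <;> linarith
  have h := sum_weight_boundedForest (n := n) hp hp1 one_pos ⊤
  have h1 : 1 / (1 + N) / (1 - 1 / (1 + N)) = 1 / N := by
    have : 1 - 1 / (1 + N) = N / (1 + N) := by field_simp; ring
    rw [this]; field_simp
  have h2 : 1 * (1 - 1 / (1 + N)) / (1 / (1 + N)) = N := by field_simp; ring
  rw [h1, h2] at h
  rw [← h, bernoulliProb, Finset.sum_filter, L_eq]
  refine Fintype.sum_congr _ _ fun ω => ?_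
  by_cases hω : IsBoundedForest ⊤ (openGraph (K n) ω)
  · rw [Set.indicator_of_mem (by exact hω), if_pos hω, weight, one_pow, mul_one, bernoulliWeight]
    congr!
  · rw [Set.indicator_of_notMem (by exact hω), if_neg hω]

theorem one_sub_inv_pow (n : ℕ) {N : ℝ} (hN : 0 < N) :
    (1 - 1 / (1 + N)) ^ n * (1 + 1 / N) ^ n = 1 := by
  rw [← mul_pow, show (1 - 1 / (1 + N)) * (1 + 1 / N) = 1 by field_simp; ring, one_pow]

/-- The probability that the Erdős–Rényi graph is a forest is at most `1`. -/
theorem forestSum_le (n : ℕ) {N : ℝ} (hN : 0 < N) :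
    forestSum ⊤ n N ≤ (1 + 1 / N) ^ n.choose 2 * N ^ n := by
  have hp : 0 ≤ 1 / (1 + N) := by positivity
  have hp1 : 1 / (1 + N) ≤ 1 := by rw [div_le_one] <;> linarith
  have h1 := bernoulliProb_acyclic n hN
  have h2 := bernoulliProb_le_one hp hp1 (L n)
  rw [h1] at h2
  have h3 := one_sub_inv_pow (n.choose 2) hN
  have h4 : (1 / N) ^ n * N ^ n = 1 := by rw [← mul_pow, one_div_mul_cancel hN.ne', one_pow]
  calc forestSum ⊤ n N = ((1 - 1 / (1 + N)) ^ n.choose 2 * (1 + 1 / N) ^ n.choose 2) *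
        ((1 / N) ^ n * N ^ n) * forestSum ⊤ n N := by rw [h3, h4]; ring
    _ = ((1 - 1 / (1 + N)) ^ n.choose 2 * (1 / N) ^ n * forestSum ⊤ n N) *
        ((1 + 1 / N) ^ n.choose 2 * N ^ n) := by ring
    _ ≤ 1 * ((1 + 1 / N) ^ n.choose 2 * N ^ n) := by gcongr
    _ = _ := one_mul _

open Classical in
/-- The edges of the closed polygon through `v 0, …, v (k - 1)`, in this cyclic order; where
consecutive vertices coincide there is no edge. -/
def cyclicEdges {n k : ℕ} (v : Fin k → Fin n) : Finset (K n).edgeSet :=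
  Finset.univ.filter fun e => ∃ i, e.1 = s(v i, v (finRotate k i))

theorem exists_cyclicEdges {n : ℕ} {ω : Config (K n)} (h : ¬ (openGraph (K n) ω).IsAcyclic) :
    ∃ k ≤ n, ∃ v : Fin k → Fin n, (cyclicEdges v).card = k ∧ 1 ≤ k ∧
      ∀ e ∈ cyclicEdges v, ω e = true := by
  classical
  unfold IsAcyclic at h
  push Not at h
  obtain ⟨u, c, hc⟩ := h
  have h3 := hc.three_le_length
  set k := c.length with hk
  let v : Fin k → Fin n := fun i => c.getVert i
  have hrot : ∀ i : Fin k, v (finRotate k i) = c.getVert (i + 1) := by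
    intro i
    obtain ⟨m, hm⟩ : ∃ m, k = m + 1 := ⟨k - 1, by omega⟩
    have hval : ((finRotate k i : Fin k) : ℕ) = if (i : ℕ) + 1 = k then 0 else (i : ℕ) + 1 := by
      clear_value k
      subst hm
      rw [coe_finRotate]
      simp only [Fin.ext_iff, Fin.val_last, Nat.add_right_cancel_iff]
    change c.getVert (finRotate k i : Fin k) = _
    rw [hval]
    split_ifs with h
    · rw [h, hk, c.getVert_length, c.getVert_zero]
    · rfl
  have hedge : ∀ i : Fin k, s(v i, v (finRotate k i)) ∈ (openGraph (K n) ω).edgeSet := by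
    intro i
    rw [hrot]
    exact c.adj_getVert_succ i.2
  have hinj : Function.Injective fun i : Fin k => s(v i, v (finRotate k i)) := by
    intro i j hij
    simp only [hrot] at hij
    have hlen : c.edges.length = k := c.length_edges
    have hi : (i : ℕ) < c.edges.length := by rw [hlen]; exact i.2
    have hj : (j : ℕ) < c.edges.length := by rw [hlen]; exact j.2
    have h1 : c.edges[(i : ℕ)] = c.edges[(j : ℕ)] := by
      rw [Walk.getElem_edges, Walk.getElem_edges]; exact hij
    exact Fin.ext ((hc.edges_nodup.getElem_inj_iff).1 h1)
  have hset : ∀ i : Fin k, s(v i, v (finRotate k i)) ∈ (K n).edgeSet := fun i =>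
    edgeSet_mono le_top (hedge i)
  refine ⟨k, ?_, v, ?_, by omega, ?_⟩
  · have hv : Function.Injective v := by
      intro i j hij
      exact Fin.ext (hc.getVert_injOn' (by simp only [Set.mem_ofPred_eq]; omega)
        (by simp only [Set.mem_ofPred_eq]; omega) hij)
    simpa using Fintype.card_le_of_injective v hv
  · have : cyclicEdges v = Finset.univ.image fun i : Fin k =>
        (⟨s(v i, v (finRotate k i)), hset i⟩ : (K n).edgeSet) := by
      ext e
      simp [cyclicEdges, Subtype.ext_iff, eq_comm]
    rw [this, Finset.card_image_of_injective, Finset.card_univ, Fintype.card_fin]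
    intro i j hij
    exact hinj (congrArg Subtype.val hij)
  · intro e he
    simp only [cyclicEdges, Finset.mem_filter, Finset.mem_univ, true_and] at he
    obtain ⟨i, hi⟩ := he
    have := hedge i
    rw [← hi, edgeSet_openGraph] at this
    exact this.2

theorem exp_neg_two_mul_le {y : ℝ} (h0 : 0 ≤ y) (h1 : y ≤ 1 / 2) : Real.exp (-(2 * y)) ≤ 1 - y := by
  rw [Real.exp_neg]
  refine (inv_anti₀ (by linarith) (Real.add_one_le_exp (2 * y))).trans ?_
  rw [inv_le_iff_one_le_mul₀ (by linarith)]
  nlinarith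

/-- In the subcritical phase the Erdős–Rényi graph is a forest with probability bounded below,
uniformly in `n`: at most `n ^ k` polygons have `k` edges, each is open with probability `p ^ k`,
and their absences are positively correlated. -/
theorem exp_le_bernoulliProb_acyclic (n : ℕ) {p x : ℝ} (hp : 0 ≤ p) (hp2 : p ≤ 1 / 2)
    (hx : n * p ≤ x) (hx1 : x < 1) : Real.exp (-(2 * (1 - x)⁻¹)) ≤ bernoulliProb p (L n) := by
  classical
  let s : Finset (Σ k : Fin (n + 1), Fin k → Fin n) :=
    Finset.univ.filter fun i => (cyclicEdges i.2).card = i.1 ∧ 1 ≤ (i.1 : ℕ)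
  have hsub : {ω : Config (K n) | ∀ i ∈ s, ¬ ∀ e ∈ cyclicEdges i.2, ω e = true} ⊆ L n := by
    intro ω hω
    by_contra hcyc
    obtain ⟨k, hkn, v, hcard, hk1, hopen⟩ := exists_cyclicEdges hcyc
    exact hω ⟨⟨k, by omega⟩, v⟩ (Finset.mem_filter.2 ⟨Finset.mem_univ _, hcard, hk1⟩) hopen
  refine le_trans ?_ ((prod_le_bernoulliProb hp (by linarith) s fun i => cyclicEdges i.2).trans
    (bernoulliProb_mono hp (by linarith) hsub))
  have hsum : ∑ i ∈ s, p ^ (i.1 : ℕ) ≤ (1 - x)⁻¹ := by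
    have hx0 : 0 ≤ n * p := by positivity
    calc ∑ i ∈ s, p ^ (i.1 : ℕ) ≤ ∑ i : (Σ k : Fin (n + 1), Fin k → Fin n), p ^ (i.1 : ℕ) :=
          Finset.sum_le_sum_of_subset_of_nonneg (Finset.subset_univ _) fun _ _ _ => by positivity
      _ = ∑ k : Fin (n + 1), (n * p) ^ (k : ℕ) := by
          rw [Fintype.sum_sigma]
          refine Finset.sum_congr rfl fun k _ => ?_
          simp [mul_pow]
      _ = ∑ k ∈ Finset.range (n + 1), (n * p) ^ k := Fin.sum_univ_eq_sum_range _ _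
      _ ≤ ∑ k ∈ Finset.range (n + 1), x ^ k := by gcongr
      _ ≤ ∑' k, x ^ k := (summable_geometric_of_lt_one (hx0.trans hx) hx1).sum_le_tsum _
          fun _ _ => pow_nonneg (hx0.trans hx) _
      _ = (1 - x)⁻¹ := tsum_geometric_of_lt_one (hx0.trans hx) hx1
  calc Real.exp (-(2 * (1 - x)⁻¹)) ≤ Real.exp (∑ i ∈ s, -(2 * p ^ (i.1 : ℕ))) := by
        rw [Finset.sum_neg_distrib, ← Finset.mul_sum]
        gcongr
    _ = ∏ i ∈ s, Real.exp (-(2 * p ^ (i.1 : ℕ))) := Real.exp_sum _ _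
    _ ≤ ∏ i ∈ s, (1 - p ^ (cyclicEdges i.2).card) := by
        refine Finset.prod_le_prod (fun _ _ => (Real.exp_pos _).le) fun i hi => ?_
        obtain ⟨h1, h2⟩ := (Finset.mem_filter.1 hi).2
        rw [h1]
        refine exp_neg_two_mul_le (by positivity) (le_trans ?_ hp2)
        exact pow_le_of_le_one hp (by linarith) (by omega)

/-- The lower bound that matches `forestSum_le` up to a constant factor, for `n / N` below `1`. -/
theorem le_forestSum {n : ℕ} {N x : ℝ} (hN : 1 ≤ N) (hx : n ≤ x * N) (hx1 : x < 1) :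
    Real.exp (-(2 * (1 - x)⁻¹)) * ((1 + 1 / N) ^ n.choose 2 * N ^ n) ≤ forestSum ⊤ n N := by
  have hN0 : 0 < N := by linarith
  have hp : 0 ≤ 1 / (1 + N) := by positivity
  have hp2 : 1 / (1 + N) ≤ 1 / 2 := by gcongr; linarith
  have hx0 : 0 ≤ x := nonneg_of_mul_nonneg_left ((Nat.cast_nonneg n).trans hx) hN0
  have hnp : n * (1 / (1 + N)) ≤ x := by
    rw [mul_one_div, div_le_iff₀ (by linarith)]
    nlinarith
  have h2 := exp_le_bernoulliProb_acyclic n hp hp2 hnp hx1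
  rw [bernoulliProb_acyclic n hN0] at h2
  have h3 := one_sub_inv_pow (n.choose 2) hN0
  have h4 : (1 / N) ^ n * N ^ n = 1 := by rw [← mul_pow, one_div_mul_cancel hN0.ne', one_pow]
  calc _ ≤ ((1 - 1 / (1 + N)) ^ n.choose 2 * (1 / N) ^ n * forestSum ⊤ n N) *
        ((1 + 1 / N) ^ n.choose 2 * N ^ n) := by gcongr
    _ = ((1 - 1 / (1 + N)) ^ n.choose 2 * (1 + 1 / N) ^ n.choose 2) *
        ((1 / N) ^ n * N ^ n) * forestSum ⊤ n N := by ring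
    _ = _ := by rw [h3, h4]; ring

/-! ### Layered forests -/

/-- A graph is acyclic if each vertex has at most one neighbour that is not higher. -/
theorem isAcyclic_of_height {V : Type*} {G : SimpleGraph V} (h : V → ℕ)
    (H : ∀ v w w', G.Adj v w → G.Adj v w' → h w ≤ h v → h w' ≤ h v → w = w') : G.IsAcyclic := by
  classical
  intro u c hc
  -- both neighbours on the cycle of its highest vertex are not higher than that vertex
  obtain ⟨x, hx, hmax⟩ := c.support.toFinset.exists_max_image h ⟨u, by simp⟩
  rw [List.mem_toFinset] at hx
  have hc' := hc.rotate hx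
  have hsup : ∀ y ∈ (c.rotate x hx).support, h y ≤ h x := fun y hy =>
    hmax y (List.mem_toFinset.2 ((Walk.mem_support_rotate_iff c x hx).1 hy))
  have hnil := hc'.not_nil
  exact hc'.snd_ne_penultimate (H x _ _ ((c.rotate x hx).adj_snd hnil)
    ((c.rotate x hx).adj_penultimate hnil).symm (hsup _ (Walk.getVert_mem_support _ _))
    (hsup _ (Walk.getVert_mem_support _ _)))

/-- The distance to the set of roots is determined by the graph and the roots: two height functions
with the same zeros that change by one along edges, and from each vertex of positive height drop
along some edge, agree. -/
theorem height_unique {V : Type*} {G : SimpleGraph V} {h h' : V → ℕ}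
    (hadj : ∀ v w, G.Adj v w → h v = h w + 1 ∨ h w = h v + 1)
    (hadj' : ∀ v w, G.Adj v w → h' v = h' w + 1 ∨ h' w = h' v + 1)
    (hpar : ∀ v i, h v = i + 1 → ∃ w, G.Adj v w ∧ h w = i)
    (hpar' : ∀ v i, h' v = i + 1 → ∃ w, G.Adj v w ∧ h' w = i)
    (h0 : ∀ v, h v = 0 ↔ h' v = 0) : h = h' := by
  have key : ∀ i v, h v = i ↔ h' v = i := by
    intro i
    induction i using Nat.strong_induction_on with
    | _ i ih =>
      intro v
      rcases i with _ | i
      · exact h0 v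
      · constructor
        · intro hv
          obtain ⟨w, hvw, hw⟩ := hpar v i hv
          have hw' := (ih i (by omega) w).1 hw
          rcases hadj' v w hvw with h1 | h1
          · omega
          · have := (ih (h' v) (by omega) v).2 rfl
            omega
        · intro hv
          obtain ⟨w, hvw, hw⟩ := hpar' v i hv
          have hw' := (ih i (by omega) w).2 hw
          rcases hadj v w hvw with h1 | h1
          · omega
          · have := (ih (h v) (by omega) v).1 rfl
            omega
  funext v
  exact ((key _ v).1 rfl).symm

section Layered

variable {M l : ℕ}

/-- The layered forest with layers `{i} × Fin l`, `i ≤ M`, in which the vertex `(i + 1, j)` is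
attached to `(i, p i j)`. -/
def layeredGraph (p : Fin M → Fin l → Fin l) : SimpleGraph (Fin (M + 1) × Fin l) :=
  SimpleGraph.fromRel fun x y => ∃ i : Fin M, x.1 = i.castSucc ∧ y.1 = i.succ ∧ p i y.2 = x.2

theorem layeredGraph_adj {p : Fin M → Fin l → Fin l} {x y : Fin (M + 1) × Fin l} :
    (layeredGraph p).Adj x y ↔
      (∃ i : Fin M, x.1 = i.castSucc ∧ y.1 = i.succ ∧ p i y.2 = x.2) ∨
        ∃ i : Fin M, y.1 = i.castSucc ∧ x.1 = i.succ ∧ p i x.2 = y.2 := by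
  rw [layeredGraph, fromRel_adj, and_iff_right_iff_imp]
  rintro (⟨i, h1, h2, -⟩ | ⟨i, h1, h2, -⟩) rfl <;> rw [h1, Fin.ext_iff] at h2 <;> simp at h2

theorem layeredGraph_adj_height {p : Fin M → Fin l → Fin l} {x y : Fin (M + 1) × Fin l}
    (h : (layeredGraph p).Adj x y) :
    (x.1 : ℕ) = (y.1 : ℕ) + 1 ∨ (y.1 : ℕ) = (x.1 : ℕ) + 1 := by
  rcases layeredGraph_adj.1 h with ⟨i, h1, h2, -⟩ | ⟨i, h1, h2, -⟩
  · right; simp [h1, h2]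
  · left; simp [h1, h2]

theorem layeredGraph_adj_parent (p : Fin M → Fin l → Fin l) (i : Fin M) (j : Fin l) :
    (layeredGraph p).Adj (i.succ, j) (i.castSucc, p i j) :=
  layeredGraph_adj.2 (Or.inr ⟨i, rfl, rfl, rfl⟩)

theorem eq_parent_of_layeredGraph_adj {p : Fin M → Fin l → Fin l} {x y : Fin (M + 1) × Fin l}
    (h : (layeredGraph p).Adj x y) (hxy : (y.1 : ℕ) ≤ (x.1 : ℕ)) :
    ∃ i : Fin M, x.1 = i.succ ∧ y = (i.castSucc, p i x.2) := by
  rcases layeredGraph_adj.1 h with ⟨i, h1, h2, -⟩ | ⟨i, h1, h2, h3⟩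
  · rw [h1, h2] at hxy; simp at hxy
  · exact ⟨i, h2, Prod.ext h1 h3.symm⟩

theorem isAcyclic_layeredGraph (p : Fin M → Fin l → Fin l) : (layeredGraph p).IsAcyclic := by
  refine isAcyclic_of_height (fun x => (x.1 : ℕ)) fun v w w' hw hw' h h' => ?_
  obtain ⟨i, hi, rfl⟩ := eq_parent_of_layeredGraph_adj hw h
  obtain ⟨i', hi', rfl⟩ := eq_parent_of_layeredGraph_adj hw' h'
  obtain rfl : i = i' := Fin.succ_injective _ (hi.symm.trans hi')
  rfl

theorem layeredGraph_injective :
    Function.Injective (layeredGraph : (Fin M → Fin l → Fin l) → _) := by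
  intro p p' h
  funext i j
  have h1 := layeredGraph_adj_parent p i j
  rw [h] at h1
  obtain ⟨i', hi', h2⟩ := eq_parent_of_layeredGraph_adj h1 (by simp)
  obtain rfl : i = i' := Fin.succ_injective _ hi'
  exact congrArg Prod.snd h2

/-- A labelled copy of a layered forest and the labels of its roots determine the layers. -/
theorem layer_eq_of_map_eq {X : Type*} {σ σ' : Fin (M + 1) × Fin l ≃ X}
    {p p' : Fin M → Fin l → Fin l}
    (hF : (layeredGraph p).comap σ.symm = (layeredGraph p').comap σ'.symm)
    (h0 : ∀ j, σ (0, j) = σ' (0, j)) (x : X) : (σ.symm x).1 = (σ'.symm x).1 := by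
  have hpar : ∀ (τ : Fin (M + 1) × Fin l ≃ X) (q : Fin M → Fin l → Fin l) (v : X) (i : ℕ),
      ((τ.symm v).1 : ℕ) = i + 1 →
        ∃ w, ((layeredGraph q).comap τ.symm).Adj v w ∧ ((τ.symm w).1 : ℕ) = i := by
    intro τ q v i hv
    have hi : i < M := by have := (τ.symm v).1.2; omega
    refine ⟨τ ((⟨i, hi⟩ : Fin M).castSucc, q ⟨i, hi⟩ (τ.symm v).2), ?_, by simp⟩
    have := layeredGraph_adj_parent q ⟨i, hi⟩ (τ.symm v).2
    rw [comap_adj, τ.symm_apply_apply]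
    have hv' : τ.symm v = ((⟨i, hi⟩ : Fin M).succ, (τ.symm v).2) := Prod.ext (Fin.ext hv) rfl
    rwa [← hv'] at this
  have hzero : ∀ (τ τ' : Fin (M + 1) × Fin l ≃ X), (∀ j, τ (0, j) = τ' (0, j)) → ∀ v,
      ((τ.symm v).1 : ℕ) = 0 → ((τ'.symm v).1 : ℕ) = 0 := by
    intro τ τ' h v hv
    have h1 : v = τ (0, (τ.symm v).2) := by
      rw [← Equiv.symm_apply_eq]
      exact Prod.ext (Fin.ext hv) rfl
    rw [h1, h, τ'.symm_apply_apply]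
    rfl
  have := height_unique (G := (layeredGraph p).comap σ.symm)
    (h := fun v => ((σ.symm v).1 : ℕ)) (h' := fun v => ((σ'.symm v).1 : ℕ))
    (fun v w h => layeredGraph_adj_height h)
    (fun v w h => by rw [hF] at h; exact layeredGraph_adj_height h)
    (hpar σ p) (by rw [hF]; exact hpar σ' p')
    fun v => ⟨hzero _ _ h0 v, hzero _ _ (fun j => (h0 j).symm) v⟩
  exact Fin.ext (congrFun this x)

end Layered

/-- A lower bound for the number of forests on `n = (M + 1) l` vertices, from the `n! * l ^ (l * M)`
labelled layered forests with parents: a forest arises from at most `(l!) ^ (M + 1)` of them for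
each choice of the labels of its roots. -/
theorem factorial_mul_pow_le_forestSum (M l : ℕ) :
    ((((M + 1) * l).factorial * l ^ (l * M) : ℕ) : ℝ) ≤
      (l.factorial ^ (M + 1) * ((M + 1) * l) ^ l : ℕ) * forestSum ⊤ ((M + 1) * l) 1 := by
  classical
  set n := (M + 1) * l with hn
  let Φ : ((Fin (M + 1) × Fin l ≃ Fin n) × (Fin M → Fin l → Fin l)) →
      SimpleGraph (Fin n) × (Fin l → Fin n) :=
    fun x => ((layeredGraph x.2).comap x.1.symm, fun j => x.1 (0, j))
  have hfib : ∀ b ∈ Finset.univ.image Φ,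
      (Finset.univ.filter fun a => Φ a = b).card ≤ l.factorial ^ (M + 1) := by
    intro b hb
    obtain ⟨⟨σ, p⟩, -, rfl⟩ := Finset.mem_image.1 hb
    have hlayer : ∀ a, Φ a = Φ (σ, p) → ∀ y, (σ.symm (a.1 y)).1 = y.1 := by
      rintro ⟨τ, q⟩ h y
      have := layer_eq_of_map_eq (congrArg Prod.fst h)
        (fun j => congrFun (congrArg Prod.snd h) j) (τ y)
      rw [← this, Equiv.symm_apply_apply]
    -- within a fibre, the labelling is a reference labelling up to a permutation in each layer
    let T : Finset (Fin (M + 1) → Fin l → Fin l) :=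
      Fintype.piFinset fun _ => Finset.univ.filter Function.Injective
    have hT : T.card = l.factorial ^ (M + 1) := by
      rw [Fintype.card_piFinset_const, ← Fintype.card_subtype,
        Fintype.card_congr (Equiv.subtypeInjectiveEquivEmbedding _ _), Fintype.card_embedding_eq,
        Fintype.card_fin, Nat.descFactorial_self]
    rw [← hT]
    refine Finset.card_le_card_of_injOn (fun a i j => (σ.symm (a.1 (i, j))).2) ?_ ?_
    · intro a ha
      have ha' := hlayer a (Finset.mem_filter.1 ha).2
      simp only [T, Finset.mem_coe, Fintype.mem_piFinset, Finset.mem_filter, Finset.mem_univ,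
        true_and]
      intro i j j' hjj
      have : σ.symm (a.1 (i, j)) = σ.symm (a.1 (i, j')) :=
        Prod.ext ((ha' (i, j)).trans (ha' (i, j')).symm) hjj
      exact congrArg Prod.snd (a.1.injective (σ.symm.injective this))
    · rintro ⟨τ, q⟩ ha ⟨τ', q'⟩ ha' h
      have ha1 := (Finset.mem_filter.1 ha).2
      have ha2 := (Finset.mem_filter.1 ha').2
      have hτ : τ = τ' := by
        ext1 y
        refine σ.symm.injective (Prod.ext ?_ (congrFun (congrFun h y.1) y.2))
        exact (hlayer _ ha1 y).trans (hlayer _ ha2 y).symm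
      subst hτ
      have hq := congrArg Prod.fst (ha1.trans ha2.symm)
      have : layeredGraph q = layeredGraph q' := by
        ext v w
        have := congrFun (congrFun (congrArg SimpleGraph.Adj hq) (τ v)) (τ w)
        simpa [Φ] using this
      rw [layeredGraph_injective this]
  have h1 := Finset.card_le_mul_card_image Finset.univ _ hfib
  have h2 : (Finset.univ.image Φ).card ≤
      (Finset.univ.filter fun F : SimpleGraph (Fin n) => IsBoundedForest ⊤ F).card * n ^ l := by
    have : (n ^ l) = (Finset.univ : Finset (Fin l → Fin n)).card := by simp
    rw [this, ← Finset.card_product]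
    refine Finset.card_le_card fun b hb => ?_
    obtain ⟨⟨σ, p⟩, -, rfl⟩ := Finset.mem_image.1 hb
    refine Finset.mem_product.2 ⟨Finset.mem_filter.2 ⟨Finset.mem_univ _, ?_, fun _ => le_top⟩,
      Finset.mem_univ _⟩
    exact (isAcyclic_layeredGraph p).comap (Iso.comap σ.symm _).toHom
      (Iso.comap σ.symm _).injective
  have h3 : (Finset.univ : Finset ((Fin (M + 1) × Fin l ≃ Fin n) ×
      (Fin M → Fin l → Fin l))).card = n.factorial * l ^ (l * M) := by
    rw [Finset.card_univ, Fintype.card_prod, Fintype.card_equiv finProdFinEquiv]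
    simp [← pow_mul, hn]
  have h4 : forestSum ⊤ n 1 =
      (Finset.univ.filter fun F : SimpleGraph (Fin n) => IsBoundedForest ⊤ F).card := by
    simp [forestSum]
  rw [h3] at h1
  rw [h4]
  have h5 := h1.trans (Nat.mul_le_mul_left _ h2)
  rw [mul_comm _ (n ^ l), ← mul_assoc] at h5
  exact_mod_cast h5

/-! ### The growth rate of the forest polynomial -/

/-- `forestSum r n N / n!`, the `n`-th coefficient of the exponential generating function of
the forests counted by `forestSum`. -/
def forestCoeff (r : ℕ∞) (n : ℕ) (N : ℝ) : ℝ := forestSum r n N / n.factorial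

/-- Here `n = 0` is allowed: the empty graph has no component, and `0 ^ 0 = 1`. -/
theorem forestSum_mul_pos {r : ℕ∞} (hr : 1 ≤ r) (n : ℕ) {t : ℝ} (ht : 0 < t) :
    0 < forestSum r n (t * n) := by
  rcases Nat.eq_zero_or_pos n with rfl | hn
  · classical
    refine Finset.sum_pos (fun G _ => ?_)
      ⟨⊥, Finset.mem_filter.2 ⟨Finset.mem_univ _, isBoundedForest_bot hr⟩⟩
    have h : Nat.card G.ConnectedComponent = 0 := by
      have := natCard_component_le G
      rw [Nat.card_fin] at this
      omega
    rw [h, pow_zero]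
    exact one_pos
  · exact forestSum_pos hr n (by positivity)

theorem forestCoeff_mul_pos {r : ℕ∞} (hr : 1 ≤ r) (n : ℕ) {t : ℝ} (ht : 0 < t) :
    0 < forestCoeff r n (t * n) :=
  div_pos (forestSum_mul_pos hr n ht) (by positivity)

theorem forestCoeff_pos {r : ℕ∞} (hr : 1 ≤ r) (n : ℕ) {N : ℝ} (hN : 0 < N) :
    0 < forestCoeff r n N :=
  div_pos (forestSum_pos hr n hN) (by positivity)

theorem forestCoeff_mono (r : ℕ∞) (n : ℕ) {N M : ℝ} (hN : 0 ≤ N) (hNM : N ≤ M) :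
    forestCoeff r n N ≤ forestCoeff r n M :=
  div_le_div_of_nonneg_right (forestSum_mono r n hN hNM) (by positivity)

theorem forestCoeff_le_pow_mul (r : ℕ∞) (n : ℕ) {N M : ℝ} (hN : 0 < N) (hNM : N ≤ M) :
    forestCoeff r n M ≤ (M / N) ^ n * forestCoeff r n N := by
  rw [forestCoeff, forestCoeff, ← mul_div_assoc]
  exact div_le_div_of_nonneg_right (forestSum_le_pow_mul r n hN hNM) (by positivity)

theorem forestCoeff_mul_forestCoeff_le (r : ℕ∞) (n m : ℕ) {N M : ℝ} (hN : 0 ≤ N) (hM : 0 ≤ M) :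
    forestCoeff r n N * forestCoeff r m M ≤ forestCoeff r (n + m) (N + M) := by
  have h := choose_mul_forestSum_mul_forestSum_le r n m hN hM
  rw [Nat.cast_add_choose] at h
  rw [forestCoeff, forestCoeff, forestCoeff, le_div_iff₀ (by positivity)]
  calc _ = _ := by ring
    _ ≤ _ := h

/-- `log (forestCoeff r n (t n))`, whose growth rate in `n` is `forestRate r t`. -/
def logCoeff (r : ℕ∞) (t : ℝ) (n : ℕ) : ℝ := Real.log (forestCoeff r n (t * n))

/-- The exponential growth rate of `forestCoeff r n (t n)` as `n → ∞`, defined as the supremum that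
Fekete's lemma identifies with the limit. The index is shifted to avoid `n = 0`. -/
def forestRate (r : ℕ∞) (t : ℝ) : ℝ := ⨆ n : ℕ, logCoeff r t (n + 1) / ((n + 1 : ℕ) : ℝ)

theorem logCoeff_add_le {r : ℕ∞} (hr : 1 ≤ r) {s t w : ℝ} (hs : 0 < s) (ht : 0 < t) (n m : ℕ)
    (hw : s * n + t * m ≤ w * (n + m : ℕ)) :
    logCoeff r s n + logCoeff r t m ≤ logCoeff r w (n + m) := by
  have h1 := forestCoeff_mul_pos hr n hs
  have h2 := forestCoeff_mul_pos hr m ht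
  rw [logCoeff, logCoeff, ← Real.log_mul h1.ne' h2.ne', logCoeff]
  refine Real.log_le_log (mul_pos h1 h2) ?_
  exact (forestCoeff_mul_forestCoeff_le r n m (by positivity) (by positivity)).trans
    (forestCoeff_mono r _ (by positivity) hw)

theorem subadditive_neg_logCoeff {r : ℕ∞} (hr : 1 ≤ r) {t : ℝ} (ht : 0 < t) :
    Subadditive fun n => -logCoeff r t n := by
  intro n m
  have := logCoeff_add_le hr ht ht n m (w := t) (by push_cast; linarith)
  linarith

theorem choose_two_div {n : ℕ} (hn : n ≠ 0) (t : ℝ) :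
    (n.choose 2 : ℝ) / (t * n) = ((n : ℝ) - 1) / (2 * t) := by
  rw [Nat.cast_choose_two]
  field_simp

theorem logCoeff_le {r : ℕ∞} (hr : 1 ≤ r) {t : ℝ} (ht : 0 < t) {n : ℕ} (hn : n ≠ 0) :
    logCoeff r t n ≤ n * (1 + Real.log t + 1 / (2 * t)) := by
  have hN : 0 < t * n := by positivity
  rw [logCoeff, Real.log_le_iff_le_exp (forestCoeff_mul_pos hr n ht), forestCoeff]
  have h1 := (forestSum_mono_bound (le_top : r ≤ ⊤) n hN.le).trans (forestSum_le n hN)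
  have h2 : (1 + 1 / (t * n)) ^ n.choose 2 ≤ Real.exp (n * (1 / (2 * t))) := by
    calc (1 + 1 / (t * n)) ^ n.choose 2 ≤ Real.exp (1 / (t * n)) ^ n.choose 2 := by
          gcongr
          rw [add_comm]
          exact Real.add_one_le_exp _
      _ = Real.exp (n.choose 2 / (t * n)) := by rw [← Real.exp_nat_mul]; ring_nf
      _ ≤ _ := by
          rw [choose_two_div hn]
          gcongr
          rw [mul_one_div]
          gcongr
          linarith
  have h3 : (n : ℝ) ^ n / n.factorial ≤ Real.exp n :=
    Real.pow_div_factorial_le_exp _ (by positivity) n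
  calc forestSum r n (t * n) / n.factorial
      ≤ ((1 + 1 / (t * n)) ^ n.choose 2 * (t * n) ^ n) / n.factorial := by gcongr
    _ = (1 + 1 / (t * n)) ^ n.choose 2 * t ^ n * ((n : ℝ) ^ n / n.factorial) := by
        rw [mul_pow]; ring
    _ ≤ Real.exp (n * (1 / (2 * t))) * t ^ n * Real.exp n := by gcongr
    _ = Real.exp (n * (1 + Real.log t + 1 / (2 * t))) := by
        rw [← Real.exp_log ht, ← Real.exp_nat_mul, ← Real.exp_add, ← Real.exp_add, Real.exp_log ht]
        congr 1; ring

theorem logCoeff_div_le {r : ℕ∞} (hr : 1 ≤ r) {t : ℝ} (ht : 0 < t) {n : ℕ} (hn : n ≠ 0) :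
    logCoeff r t n / n ≤ 1 + Real.log t + 1 / (2 * t) := by
  rw [div_le_iff₀' (by positivity)]
  exact logCoeff_le hr ht hn

theorem bddAbove_logCoeff {r : ℕ∞} (hr : 1 ≤ r) {t : ℝ} (ht : 0 < t) :
    BddAbove (Set.range fun n : ℕ => logCoeff r t (n + 1) / ((n + 1 : ℕ) : ℝ)) := by
  refine ⟨1 + Real.log t + 1 / (2 * t), ?_⟩
  rintro _ ⟨n, rfl⟩
  exact logCoeff_div_le hr ht (Nat.succ_ne_zero n)

theorem logCoeff_div_le_forestRate {r : ℕ∞} (hr : 1 ≤ r) {t : ℝ} (ht : 0 < t) {n : ℕ}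
    (hn : n ≠ 0) : logCoeff r t n / n ≤ forestRate r t := by
  obtain ⟨m, rfl⟩ := Nat.exists_eq_succ_of_ne_zero hn
  exact le_ciSup (bddAbove_logCoeff hr ht) m

theorem forestRate_le {r : ℕ∞} (hr : 1 ≤ r) {t : ℝ} (ht : 0 < t) :
    forestRate r t ≤ 1 + Real.log t + 1 / (2 * t) :=
  ciSup_le fun n => logCoeff_div_le hr ht (Nat.succ_ne_zero n)

theorem tendsto_logCoeff_div {r : ℕ∞} (hr : 1 ≤ r) {t : ℝ} (ht : 0 < t) :
    Tendsto (fun n : ℕ => logCoeff r t n / n) atTop (𝓝 (forestRate r t)) := by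
  have hsub := subadditive_neg_logCoeff hr ht
  have hbdd : BddBelow (Set.range fun n : ℕ => -logCoeff r t n / n) := by
    refine ⟨min 0 (-(1 + Real.log t + 1 / (2 * t))), ?_⟩
    rintro _ ⟨n, rfl⟩
    rcases Nat.eq_zero_or_pos n with rfl | hn
    · simp
    · dsimp only
      rw [neg_div]
      exact (min_le_right _ _).trans (neg_le_neg (logCoeff_div_le hr ht hn.ne'))
  have h1 : Tendsto (fun n : ℕ => logCoeff r t n / n) atTop (𝓝 (-hsub.lim)) := by
    refine (hsub.tendsto_lim hbdd).neg.congr fun n => ?_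
    rw [neg_div, neg_neg]
  have h2 : -hsub.lim = forestRate r t := by
    refine le_antisymm ?_ (ciSup_le fun n => ?_)
    · refine le_of_tendsto h1 ?_
      filter_upwards [eventually_ne_atTop 0] with n hn
      exact logCoeff_div_le_forestRate hr ht hn
    · have := hsub.lim_le_div hbdd (Nat.succ_ne_zero n)
      rw [neg_div] at this
      exact le_neg_of_le_neg this
  rwa [h2] at h1

theorem forestRate_mono {r : ℕ∞} (hr : 1 ≤ r) {s t : ℝ} (hs : 0 < s) (hst : s ≤ t) :
    forestRate r s ≤ forestRate r t := by
  refine ciSup_mono (bddAbove_logCoeff hr (hs.trans_le hst)) fun n => ?_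
  refine div_le_div_of_nonneg_right (Real.log_le_log (forestCoeff_mul_pos hr _ hs) ?_)
    (Nat.cast_nonneg _)
  exact forestCoeff_mono r _ (by positivity) (by gcongr)

/-- Together with `forestRate_mono`: `forestRate r` is 1-Lipschitz as a function of `log t`. -/
theorem forestRate_le_add_log {r : ℕ∞} (hr : 1 ≤ r) {s t : ℝ} (hs : 0 < s) (hst : s ≤ t) :
    forestRate r t ≤ forestRate r s + Real.log (t / s) := by
  have ht := hs.trans_le hst
  refine ciSup_le fun n => ?_
  have hn : (0 : ℝ) < (n + 1 : ℕ) := by positivity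
  have h1 := forestCoeff_le_pow_mul r (n + 1) (N := s * (n + 1 : ℕ)) (M := t * (n + 1 : ℕ))
    (by positivity) (by gcongr)
  rw [mul_div_mul_right _ _ hn.ne'] at h1
  have h2 : logCoeff r t (n + 1) ≤ (n + 1 : ℕ) * Real.log (t / s) + logCoeff r s (n + 1) := by
    rw [logCoeff, logCoeff, ← Real.log_pow, ← Real.log_mul (by positivity)
      (forestCoeff_mul_pos hr _ hs).ne']
    exact Real.log_le_log (forestCoeff_mul_pos hr _ ht) h1
  have h3 := logCoeff_div_le_forestRate hr hs (Nat.succ_ne_zero n)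
  calc logCoeff r t (n + 1) / (n + 1 : ℕ)
      ≤ ((n + 1 : ℕ) * Real.log (t / s) + logCoeff r s (n + 1)) / (n + 1 : ℕ) := by gcongr
    _ = logCoeff r s (n + 1) / (n + 1 : ℕ) + Real.log (t / s) := by field_simp; ring
    _ ≤ _ := by gcongr

theorem continuousOn_forestRate {r : ℕ∞} (hr : 1 ≤ r) :
    ContinuousOn (forestRate r) (Set.Ioi 0) := by
  have hbound : ∀ s ∈ Set.Ioi (0 : ℝ), ∀ t ∈ Set.Ioi (0 : ℝ),
      |forestRate r t - forestRate r s| ≤ |Real.log t - Real.log s| := by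
    have : ∀ s t : ℝ, 0 < s → s ≤ t →
        |forestRate r t - forestRate r s| ≤ |Real.log t - Real.log s| := by
      intro s t hs hst
      have h1 := forestRate_mono hr hs hst
      have h2 := forestRate_le_add_log hr hs hst
      rw [Real.log_div (hs.trans_le hst).ne' hs.ne'] at h2
      rw [abs_of_nonneg (by linarith)]
      exact (by linarith : _ ≤ Real.log t - Real.log s).trans (le_abs_self _)
    intro s hs t ht
    rcases le_total s t with h | h
    · exact this s t hs h
    · rw [abs_sub_comm, abs_sub_comm (Real.log t)]
      exact this t s ht h
  intro s hs
  refine ContinuousAt.continuousWithinAt ?_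
  rw [ContinuousAt, tendsto_iff_dist_tendsto_zero]
  have hlog : Tendsto (fun t => |Real.log t - Real.log s|) (𝓝 s) (𝓝 0) := by
    have := ((Real.continuousAt_log (ne_of_gt hs)).tendsto.sub_const (Real.log s)).abs
    rwa [sub_self, abs_zero] at this
  refine squeeze_zero' (Eventually.of_forall fun _ => dist_nonneg) ?_ hlog
  filter_upwards [Ioi_mem_nhds hs] with t ht
  exact hbound s hs t ht

/-- Letting the bound on the component sizes tend to infinity amounts to exchanging two suprema. -/
theorem tendsto_forestRate_bound {t : ℝ} (ht : 0 < t) :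
    Tendsto (fun r : ℕ => forestRate r t) atTop (𝓝 (forestRate ⊤ t)) := by
  have hmono : ∀ (r s : ℕ∞), 1 ≤ r → r ≤ s → forestRate r t ≤ forestRate s t := by
    intro r s hr hrs
    refine ciSup_mono (bddAbove_logCoeff (hr.trans hrs) ht) fun n => ?_
    refine div_le_div_of_nonneg_right (Real.log_le_log (forestCoeff_mul_pos hr _ ht) ?_)
      (Nat.cast_nonneg _)
    exact div_le_div_of_nonneg_right (forestSum_mono_bound hrs _ (by positivity)) (by positivity)
  refine tendsto_order.2 ⟨fun a ha => ?_, fun a ha => ?_⟩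
  · obtain ⟨n, hn⟩ := exists_lt_of_lt_ciSup ha
    filter_upwards [eventually_ge_atTop (n + 1)] with r hr
    have hr1 : (1 : ℕ∞) ≤ (r : ℕ∞) := by exact_mod_cast (by omega : 1 ≤ r)
    refine hn.trans_le ((le_of_eq ?_).trans
      (logCoeff_div_le_forestRate hr1 ht (Nat.succ_ne_zero n)))
    rw [logCoeff, logCoeff, forestCoeff, forestCoeff, forestSum_eq_top (r := r)]
    exact_mod_cast hr
  · filter_upwards [eventually_ge_atTop 1] with r hr
    exact (hmono r ⊤ (by exact_mod_cast hr) le_top).trans_lt ha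

theorem tendsto_log_factorial_div_sub_log :
    Tendsto (fun n : ℕ => Real.log n.factorial / n - Real.log n) atTop (𝓝 (-1)) := by
  have h1 : Tendsto (fun n : ℕ => Real.log (Stirling.stirlingSeq n) / n) atTop (𝓝 0) :=
    ((Real.continuousAt_log (by positivity)).tendsto.comp
      Stirling.tendsto_stirlingSeq_sqrt_pi).div_atTop tendsto_natCast_atTop_atTop
  have hlog : Tendsto (fun n : ℕ => Real.log n / n) atTop (𝓝 0) :=
    (Real.isLittleO_log_id_atTop.tendsto_div_nhds_zero).comp tendsto_natCast_atTop_atTop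
  have h2 : Tendsto (fun n : ℕ => Real.log 2 / n) atTop (𝓝 0) :=
    tendsto_const_nhds.div_atTop tendsto_natCast_atTop_atTop
  have h3 := ((h1.add (h2.const_mul (1 / 2))).add (hlog.const_mul (1 / 2))).sub_const 1
  simp only [mul_zero, add_zero, zero_sub] at h3
  refine h3.congr' ?_
  filter_upwards [eventually_ne_atTop 0] with n hn
  have hn' : (n : ℝ) ≠ 0 := by exact_mod_cast hn
  have := Stirling.log_stirlingSeq_formula n
  rw [Real.log_mul two_ne_zero hn', Real.log_div hn' (Real.exp_ne_zero _), Real.log_exp] at this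
  rw [this]
  field_simp
  ring

/-! ### The value of the unbounded growth rate -/

theorem tendsto_sub_one_mul_log {a : ℝ} :
    Tendsto (fun n : ℕ => ((n : ℝ) - 1) / 2 * Real.log (1 + a / n)) atTop (𝓝 (a / 2)) := by
  have h1 : Tendsto (fun n : ℕ => (n : ℝ) * Real.log (1 + a / n)) atTop (𝓝 a) :=
    (Real.tendsto_mul_log_one_add_div_atTop a).comp tendsto_natCast_atTop_atTop
  have h2 : Tendsto (fun n : ℕ => a / (n : ℝ)) atTop (𝓝 0) :=
    tendsto_const_nhds.div_atTop tendsto_natCast_atTop_atTop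
  have h3 : Tendsto (fun n : ℕ => Real.log (1 + a / n)) atTop (𝓝 0) := by
    have := (h2.const_add 1).log (by norm_num)
    simpa using this
  have h4 := (h1.sub h3).div_const 2
  rw [sub_zero] at h4
  refine h4.congr fun n => by ring

theorem log_forestCoeff (r : ℕ∞) (n : ℕ) {N : ℝ} (h : forestSum r n N ≠ 0) :
    Real.log (forestCoeff r n N) = Real.log (forestSum r n N) - Real.log n.factorial :=
  Real.log_div h (by positivity)

/-- The subcritical phase of the forest model. -/
theorem le_forestRate_of_one_lt {t : ℝ} (ht : 1 < t) :
    1 + Real.log t + 1 / (2 * t) ≤ forestRate ⊤ t := by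
  have ht0 : 0 < t := by linarith
  have hx1 : 1 / t < 1 := (div_lt_one ht0).2 ht
  set c := Real.log (Real.exp (-(2 * (1 - 1 / t)⁻¹))) with hc
  have hlim : Tendsto (fun n : ℕ => c / n + ((n : ℝ) - 1) / 2 * Real.log (1 + 1 / t / n) +
      Real.log t - (Real.log n.factorial / n - Real.log n)) atTop
      (𝓝 (0 + 1 / t / 2 + Real.log t - -1)) :=
    (((tendsto_const_nhds.div_atTop tendsto_natCast_atTop_atTop).add
      tendsto_sub_one_mul_log).add_const _).sub tendsto_log_factorial_div_sub_log
  have hval : 0 + 1 / t / 2 + Real.log t - -1 = 1 + Real.log t + 1 / (2 * t) := by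
    field_simp; ring
  rw [← hval]
  refine le_of_tendsto hlim ?_
  filter_upwards [eventually_ne_atTop 0] with n hn
  have hn1 : (1 : ℝ) ≤ n := by exact_mod_cast Nat.one_le_iff_ne_zero.2 hn
  have hn0 : (0 : ℝ) < n := by linarith
  have h1 := le_forestSum (n := n) (N := t * n) (x := 1 / t) (by nlinarith)
    (by field_simp; exact le_rfl) hx1
  have h2 := Real.log_le_log (by positivity) h1
  rw [Real.log_mul (by positivity) (by positivity), Real.log_mul (by positivity) (by positivity),
    Real.log_pow, Real.log_pow, Real.log_mul ht0.ne' hn0.ne', ← hc] at h2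
  have h3 : c + n.choose 2 * Real.log (1 + 1 / (t * n)) + n * (Real.log t + Real.log n) -
      Real.log n.factorial ≤ logCoeff ⊤ t n := by
    rw [logCoeff, log_forestCoeff _ _ (forestSum_mul_pos le_top n ht0).ne']
    linarith
  refine le_trans (le_of_eq ?_) ((div_le_div_of_nonneg_right h3 hn0.le).trans
    (logCoeff_div_le_forestRate le_top ht0 hn))
  rw [Nat.cast_choose_two, div_div]
  field_simp
  ring

theorem le_forestRate_one : 3 / 2 ≤ forestRate ⊤ 1 := by
  have hlim : Tendsto (fun t : ℝ => 1 + 1 / (2 * t)) (𝓝[>] 1) (𝓝 (1 + 1 / (2 * 1))) := by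
    refine Tendsto.mono_left ?_ nhdsWithin_le_nhds
    exact (tendsto_const_nhds.div (tendsto_id.const_mul 2) (by norm_num)).const_add 1
  have : (3 / 2 : ℝ) = 1 + 1 / (2 * 1) := by norm_num
  rw [this]
  refine le_of_tendsto hlim ?_
  filter_upwards [self_mem_nhdsWithin] with t ht
  have h1 := le_forestRate_of_one_lt ht
  have h2 := forestRate_le_add_log (r := ⊤) le_top one_pos (le_of_lt ht)
  rw [div_one] at h2
  linarith

/-- The layered forests show that the number of forests on `n` vertices grows like
`n! e ^ (n (1 + o(1)))` at least. -/
theorem one_le_forestRate {t : ℝ} (ht : 0 < t) : 1 ≤ forestRate ⊤ t := by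
  have key : ∀ l : ℕ, 1 ≤ l → Real.log l - Real.log l.factorial / l ≤ forestRate ⊤ t := by
    intro l hl
    have hl0 : (0 : ℝ) < l := by exact_mod_cast hl
    have hlog : Tendsto (fun n : ℕ => Real.log n / n) atTop (𝓝 0) :=
      (Real.isLittleO_log_id_atTop.tendsto_div_nhds_zero).comp tendsto_natCast_atTop_atTop
    have hlim0 : Tendsto (fun n : ℕ => Real.log l - Real.log l.factorial / l -
        (l * Real.log l / n + l * (Real.log n / n))) atTop
        (𝓝 (Real.log l - Real.log l.factorial / l - (0 + l * 0))) :=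
      ((tendsto_const_nhds.div_atTop tendsto_natCast_atTop_atTop).add
        (hlog.const_mul _)).const_sub _
    rw [mul_zero, add_zero, sub_zero] at hlim0
    have hsub : Tendsto (fun M : ℕ => (M + 1) * l) atTop atTop :=
      tendsto_atTop_mono (fun M => by dsimp only [id]; nlinarith) tendsto_id
    refine le_of_tendsto (hlim0.comp hsub) ?_
    have hbig : ∀ᶠ M : ℕ in atTop, 1 ≤ t * (((M + 1) * l : ℕ) : ℝ) :=
      ((tendsto_natCast_atTop_atTop.comp hsub).const_mul_atTop ht).eventually_ge_atTop 1
    filter_upwards [hbig] with M hM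
    have h1 := factorial_mul_pow_le_forestSum M l
    simp only [Function.comp_apply]
    have hn : ((M + 1) * l) ≠ 0 := by positivity
    have hcast : (((M + 1) * l : ℕ) : ℝ) = (M + 1) * l := by push_cast; ring
    refine le_trans ?_ (logCoeff_div_le_forestRate le_top ht hn)
    rw [le_div_iff₀ (by positivity)]
    generalize hN : (M + 1) * l = n at *
    have hn0 : (0 : ℝ) < n := by positivity
    have h2 : (n.factorial * (l : ℝ) ^ (l * M)) ≤
        ((l.factorial : ℝ) ^ (M + 1) * (n : ℝ) ^ l) * forestSum ⊤ n (t * n) := by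
      push_cast at h1
      refine h1.trans ?_
      gcongr
      exact forestSum_mono ⊤ n zero_le_one hM
    have hpos := forestSum_mul_pos (r := ⊤) le_top n ht
    have h3 := Real.log_le_log (by positivity) h2
    rw [Real.log_mul (by positivity) (by positivity), Real.log_mul (by positivity) hpos.ne',
      Real.log_mul (by positivity) (by positivity), Real.log_pow, Real.log_pow, Real.log_pow] at h3
    rw [logCoeff, log_forestCoeff _ _ hpos.ne']
    have h4 : (Real.log l - Real.log l.factorial / l -
        (l * Real.log l / n + l * (Real.log n / n))) * n =
        n * Real.log l - n * Real.log l.factorial / l - (l * Real.log l + l * Real.log n) := by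
      field_simp
    rw [h4, hcast]
    push_cast at h3
    have h5 : ((M : ℝ) + 1) * l * Real.log l.factorial / l = (M + 1) * Real.log l.factorial := by
      field_simp
    rw [hcast] at h3
    rw [h5]
    linarith
  have h := tendsto_log_factorial_div_sub_log.neg
  rw [neg_neg] at h
  refine le_of_tendsto h ?_
  filter_upwards [eventually_ge_atTop 1] with l hl
  have := key l hl
  linarith

/-- Concavity of the growth rate, from splitting the `n` vertices into parts of sizes `⌊α n⌋` and
`n - ⌊α n⌋`. -/
theorem forestRate_concave {r : ℕ∞} (hr : 1 ≤ r) {s t α : ℝ} (ht : 0 < t) (hts : t ≤ s)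
    (hα : 0 < α) (hα1 : α < 1) :
    α * forestRate r s + (1 - α) * forestRate r t ≤ forestRate r (α * s + (1 - α) * t) := by
  have hs : 0 < s := ht.trans_le hts
  have hw : 0 < α * s + (1 - α) * t := by
    have := sub_pos.2 hα1
    positivity
  let a : ℕ → ℕ := fun n => ⌊α * n⌋₊
  have han : ∀ n, (a n : ℝ) ≤ α * n := fun n => Nat.floor_le (by positivity)
  have hale : ∀ n, a n ≤ n := fun n => by
    have h1 := han n
    have h2 : α * n ≤ n := mul_le_of_le_one_left (Nat.cast_nonneg n) hα1.le
    exact_mod_cast h1.trans h2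
  have hcast : ∀ n, ((n - a n : ℕ) : ℝ) = n - a n := fun n => Nat.cast_sub (hale n)
  have hatop : Tendsto a atTop atTop :=
    tendsto_nat_floor_atTop.comp (tendsto_natCast_atTop_atTop.const_mul_atTop hα)
  have hbtop : Tendsto (fun n => n - a n) atTop atTop := by
    refine tendsto_natCast_atTop_iff.1 (tendsto_atTop_mono (fun n => ?_)
      (tendsto_natCast_atTop_atTop.const_mul_atTop (sub_pos.2 hα1)))
    rw [hcast]
    linarith [han n]
  have hadiv : Tendsto (fun n : ℕ => (a n : ℝ) / n) atTop (𝓝 α) :=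
    (tendsto_nat_floor_mul_div_atTop hα.le).comp tendsto_natCast_atTop_atTop
  have hlim := (hadiv.mul ((tendsto_logCoeff_div hr hs).comp hatop)).add
    ((hadiv.const_sub 1).mul ((tendsto_logCoeff_div hr ht).comp hbtop))
  refine le_of_tendsto hlim ?_
  filter_upwards [eventually_ne_atTop 0, hatop.eventually_ne_atTop 0,
    hbtop.eventually_ne_atTop 0] with n hn ha hb
  have hn0 : (0 : ℝ) < n := by positivity
  have ha0 : (a n : ℝ) ≠ 0 := by exact_mod_cast ha
  have hb0 : ((n - a n : ℕ) : ℝ) ≠ 0 := by exact_mod_cast hb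
  have h1 := logCoeff_add_le hr hs ht (a n) (n - a n) (w := α * s + (1 - α) * t) (by
    rw [Nat.add_sub_cancel' (hale n), hcast]
    nlinarith [mul_le_mul_of_nonneg_left (han n) (sub_nonneg.2 hts)])
  rw [Nat.add_sub_cancel' (hale n)] at h1
  refine le_trans (le_of_eq ?_) ((div_le_div_of_nonneg_right h1 hn0.le).trans
    (logCoeff_div_le_forestRate hr hw hn))
  simp only [Function.comp_apply]
  have h2 : 1 - (a n : ℝ) / n = ((n - a n : ℕ) : ℝ) / n := by rw [hcast]; field_simp
  rw [h2]
  field_simp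

theorem forestRate_top_of_one_le {t : ℝ} (ht : 1 ≤ t) :
    forestRate ⊤ t = 1 + Real.log t + 1 / (2 * t) := by
  refine le_antisymm (forestRate_le le_top (by linarith)) ?_
  rcases ht.eq_or_lt with rfl | ht
  · rw [Real.log_one]; norm_num; linarith [le_forestRate_one]
  · exact le_forestRate_of_one_lt ht

theorem forestRate_top_of_le_one {t : ℝ} (ht : 0 < t) (ht1 : t ≤ 1) :
    forestRate ⊤ t = 1 + t / 2 := by
  have hone : forestRate ⊤ 1 = 3 / 2 := by
    rw [forestRate_top_of_one_le le_rfl, Real.log_one]; norm_num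
  rcases ht1.eq_or_lt with rfl | ht1
  · rw [hone]; norm_num
  refine le_antisymm ?_ ?_
  · -- the graph lies below its tangent at `1`, the limit of the chords to the right of `1`
    have hlim : Tendsto (fun s : ℝ => 3 / 2 - (1 - t) / (2 * s)) (𝓝[>] 1)
        (𝓝 (3 / 2 - (1 - t) / (2 * 1))) := by
      refine Tendsto.mono_left ?_ nhdsWithin_le_nhds
      exact (tendsto_const_nhds.div (tendsto_id.const_mul 2) (by norm_num)).const_sub _
    have hval : 1 + t / 2 = 3 / 2 - (1 - t) / (2 * 1) := by ring
    rw [hval]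
    refine ge_of_tendsto hlim ?_
    filter_upwards [self_mem_nhdsWithin] with s hs
    have hs1 : 1 < s := hs
    have hst : 0 < s - t := by linarith
    have hα : 0 < (1 - t) / (s - t) := div_pos (by linarith) hst
    have hα1 : (1 - t) / (s - t) < 1 := (div_lt_one hst).2 (by linarith)
    have h := forestRate_concave (r := ⊤) le_top ht (by linarith : t ≤ s) hα hα1
    have e1 : (1 - t) / (s - t) * s + (1 - (1 - t) / (s - t)) * t = 1 := by field_simp; ring
    rw [e1, hone, forestRate_top_of_one_le hs1.le] at h
    have hlog : 1 - s⁻¹ ≤ Real.log s := Real.one_sub_inv_le_log_of_pos (by linarith)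
    have e2 : 1 - (1 - t) / (s - t) = (s - 1) / (s - t) := by field_simp; ring
    rw [e2] at h
    have h2 : (1 - t) * (1 + (1 - s⁻¹) + 1 / (2 * s)) + (s - 1) * forestRate ⊤ t ≤
        3 / 2 * (s - t) := by
      have h3 := mul_le_mul_of_nonneg_right h hst.le
      have e3 : ((1 - t) / (s - t) * (1 + Real.log s + 1 / (2 * s)) +
          (s - 1) / (s - t) * forestRate ⊤ t) * (s - t) =
          (1 - t) * (1 + Real.log s + 1 / (2 * s)) + (s - 1) * forestRate ⊤ t := by
        field_simp
      rw [e3] at h3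
      have : (1 - t) * (1 + (1 - s⁻¹) + 1 / (2 * s)) ≤
          (1 - t) * (1 + Real.log s + 1 / (2 * s)) := by
        apply mul_le_mul_of_nonneg_left _ (by linarith)
        linarith
      linarith
    have hs0 : s ≠ 0 := by linarith
    have e4 : (s - 1) * (3 / 2 - (1 - t) / (2 * s)) =
        3 / 2 * (s - t) - (1 - t) * (1 + (1 - s⁻¹) + 1 / (2 * s)) := by field_simp; ring
    refine le_of_mul_le_mul_left ?_ (sub_pos.2 hs1)
    linarith
  · -- the graph lies above the chords from `1` to points close to `0`
    have hlim : Tendsto (fun ε : ℝ => 1 + (t - ε) / 2) (𝓝[>] 0) (𝓝 (1 + (t - 0) / 2)) := by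
      refine Tendsto.mono_left ?_ nhdsWithin_le_nhds
      exact ((tendsto_id.const_sub t).div_const 2).const_add 1
    rw [sub_zero] at hlim
    refine le_of_tendsto hlim ?_
    filter_upwards [Ioo_mem_nhdsGT ht] with ε hε
    have h1ε : 0 < 1 - ε := by linarith [hε.2]
    have hα : 0 < (t - ε) / (1 - ε) := div_pos (by linarith [hε.2]) h1ε
    have hα1 : (t - ε) / (1 - ε) < 1 := (div_lt_one h1ε).2 (by linarith)
    have h := forestRate_concave (r := ⊤) le_top hε.1 (by linarith [hε.2] : ε ≤ 1) hα hα1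
    have e1 : (t - ε) / (1 - ε) * 1 + (1 - (t - ε) / (1 - ε)) * ε = t := by field_simp; ring
    rw [e1, hone] at h
    have h2 := mul_le_mul_of_nonneg_left (one_le_forestRate hε.1) (sub_pos.2 hα1).le
    have h3 : t - ε ≤ (t - ε) / (1 - ε) := by
      rw [le_div_iff₀ h1ε]
      nlinarith [hε.1, hε.2]
    linarith

/-! ### Monotone functions and locally uniform convergence -/

/-- A pointwise limit of antitone functions is locally uniform if it is continuous. -/
theorem tendstoLocallyUniformlyOn_of_antitoneOn {f : ℕ → ℝ → ℝ} {g : ℝ → ℝ}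
    (hf : ∀ b : ℝ, ∀ᶠ n in atTop, AntitoneOn (f n) (Set.Ioc 0 b))
    (hlim : ∀ x, 0 < x → Tendsto (fun n => f n x) atTop (𝓝 (g x)))
    (hg : ContinuousOn g (Set.Ioi 0)) :
    TendstoLocallyUniformlyOn f g atTop (Set.Ioi 0) := by
  rw [Metric.tendstoLocallyUniformlyOn_iff]
  intro ε hε x hx
  have hx0 : 0 < x := hx
  have hcont : ContinuousAt g x := hg.continuousAt (Ioi_mem_nhds hx0)
  obtain ⟨δ, hδ, hball⟩ := Metric.continuousAt_iff.1 hcont (ε / 4) (by linarith)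
  set η := min (δ / 2) (x / 2) with hη
  have hη0 : 0 < η := lt_min (by linarith) (by linarith)
  have hηδ : η < δ := (min_le_left _ _).trans_lt (by linarith)
  have hηx : η < x := (min_le_right _ _).trans_lt (by linarith)
  have hclose : ∀ y, x - η ≤ y → y ≤ x + η → |g y - g x| < ε / 4 := by
    intro y h1 h2
    have h := hball (x := y) (by rw [Real.dist_eq, abs_lt]; constructor <;> linarith)
    rwa [Real.dist_eq] at h
  refine ⟨Set.Icc (x - η) (x + η), mem_nhdsWithin_of_mem_nhds
    (Icc_mem_nhds (by linarith) (by linarith)), ?_⟩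
  have hl := Metric.tendsto_nhds.1 (hlim (x - η) (by linarith)) (ε / 4) (by linarith)
  have hr := Metric.tendsto_nhds.1 (hlim (x + η) (by linarith)) (ε / 4) (by linarith)
  filter_upwards [hf (x + η), hl, hr] with n hn h1 h2 y hy
  have h3 := hn (a := x - η) ⟨by linarith, by linarith⟩ ⟨by linarith [hy.1], hy.2⟩ hy.1
  have h4 := hn (b := x + η) ⟨by linarith [hy.1], hy.2⟩ ⟨by linarith, le_rfl⟩ hy.2
  have c1 := abs_lt.1 (hclose (x - η) le_rfl (by linarith))
  have c2 := abs_lt.1 (hclose (x + η) (by linarith) le_rfl)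
  have c3 := abs_lt.1 (hclose y hy.1 hy.2)
  rw [Real.dist_eq, abs_lt] at h1 h2 ⊢
  constructor <;> linarith [h1.1, h1.2, h2.1, h2.2, c1.1, c1.2, c2.1, c2.2, c3.1, c3.2]

theorem tendstoUniformlyOn_of_antitoneOn {f : ℕ → ℝ → ℝ} {g : ℝ → ℝ} {C : Set ℝ}
    (hC : IsCompact C) (hC0 : C ⊆ Set.Ioi 0)
    (hf : ∀ b : ℝ, ∀ᶠ n in atTop, AntitoneOn (f n) (Set.Ioc 0 b))
    (hlim : ∀ x, 0 < x → Tendsto (fun n => f n x) atTop (𝓝 (g x)))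
    (hg : ContinuousOn g (Set.Ioi 0)) : TendstoUniformlyOn f g atTop C :=
  (tendstoLocallyUniformlyOn_iff_tendstoUniformlyOn_of_compact hC).1
    ((tendstoLocallyUniformlyOn_of_antitoneOn hf hlim hg).mono hC0)

/-! ### Convergence of the free energy -/

/-- The summand of `(1/n) log Z_{n,λ,q}[B_r ∩ L]` that is free of `r` and `q`. -/
def explicitPart (n : ℕ) (lam : ℝ) : ℝ :=
  ((n : ℝ) - 1) / 2 * Real.log (1 - lam / n) - Real.log (1 / lam - 1 / n) +
    (Real.log n.factorial / n - Real.log n)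

/-- The summand of `(1/n) log Z_{n,λ,q}[B_r ∩ L]` that comes from counting forests. -/
def forestPart (r : ℕ∞) (q : ℝ) (n : ℕ) (lam : ℝ) : ℝ :=
  Real.log (forestCoeff r n (q * (n - lam) / lam)) / n

theorem log_Z_eq {q : ℝ} (hq : 0 < q) {r : ℕ∞} (hr : 1 ≤ r) {n : ℕ} {lam : ℝ} (hlam : 0 < lam)
    (hn : lam < n) {A : Set (Config (K n))}
    (hA : A = {ω | IsBoundedForest r (openGraph (K n) ω)}) :
    1 / (n : ℝ) * Real.log (Z n lam q A) = explicitPart n lam + forestPart r q n lam := by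
  have hn0 : (0 : ℝ) < n := hlam.trans hn
  have hnl : (0 : ℝ) < n - lam := sub_pos.2 hn
  have hp : 0 < 1 - lam / n := sub_pos.2 ((div_lt_one hn0).2 hn)
  have hpos : 0 < forestSum r n (q * (n - lam) / lam) := forestSum_pos hr n (by positivity)
  have hlog : Real.log (1 / lam - 1 / n) = -Real.log (lam / (n - lam)) - Real.log n := by
    rw [← Real.log_inv, ← Real.log_div (by positivity) hn0.ne']
    congr 1
    field_simp
  rw [Z_eq hlam hn hq hA, Real.log_mul (by positivity) hpos.ne',
    Real.log_mul (by positivity) (by positivity), Real.log_pow, Real.log_pow, explicitPart,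
    forestPart, log_forestCoeff _ _ hpos.ne', hlog, Nat.cast_choose_two]
  field_simp
  ring

theorem antitoneOn_sub_one_mul_log (b : ℝ) :
    ∀ᶠ n : ℕ in atTop, AntitoneOn
      (fun lam => ((n : ℝ) - 1) / 2 * Real.log (1 - lam / n)) (Set.Ioc 0 b) := by
  filter_upwards [tendsto_natCast_atTop_atTop.eventually_gt_atTop (max b 1)] with n hn
  have hn1 : (1 : ℝ) < n := (le_max_right _ _).trans_lt hn
  have hnb : b < n := (le_max_left _ _).trans_lt hn
  intro x hx y hy hxy
  have : 0 < 1 - y / n := sub_pos.2 ((div_lt_one (by linarith)).2 (hy.2.trans_lt hnb))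
  refine mul_le_mul_of_nonneg_left (Real.log_le_log this ?_) (by linarith)
  gcongr

theorem tendstoUniformlyOn_explicitPart {C : Set ℝ} (hC : IsCompact C) (hC0 : C ⊆ Set.Ioi 0) :
    TendstoUniformlyOn explicitPart (fun lam => -(lam / 2) + Real.log lam - 1) atTop C := by
  have h1 : TendstoUniformlyOn
      (fun (n : ℕ) lam => ((n : ℝ) - 1) / 2 * Real.log (1 - lam / n))
      (fun lam => -(lam / 2)) atTop C := by
    refine tendstoUniformlyOn_of_antitoneOn hC hC0 antitoneOn_sub_one_mul_log (fun x _ => ?_)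
      (by fun_prop)
    have := tendsto_sub_one_mul_log (a := -x)
    simpa only [neg_div, ← sub_eq_add_neg] using this
  have h2 : TendstoUniformlyOn (fun (n : ℕ) lam => Real.log (1 / lam - 1 / n))
      (fun lam => -Real.log lam) atTop C := by
    refine tendstoUniformlyOn_of_antitoneOn hC hC0 (fun b => ?_) (fun x hx => ?_) ?_
    · filter_upwards [tendsto_natCast_atTop_atTop.eventually_gt_atTop b] with n hn x hx y hy hxy
      have hyn : y < n := hy.2.trans_lt hn
      refine Real.log_le_log (sub_pos.2 (one_div_lt_one_div_of_lt hy.1 hyn)) ?_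
      exact sub_le_sub_right (one_div_le_one_div_of_le hx.1 hxy) _
    · have h : Tendsto (fun n : ℕ => 1 / x - 1 / (n : ℝ)) atTop (𝓝 (1 / x - 0)) :=
        tendsto_one_div_atTop_nhds_zero_nat.const_sub _
      have := h.log (by rw [sub_zero]; positivity)
      rwa [sub_zero, Real.log_div one_ne_zero hx.ne', Real.log_one, zero_sub] at this
    · exact (Real.continuousOn_log.mono fun x hx => ne_of_gt hx).neg
  have h3 : TendstoUniformlyOn
      (fun (n : ℕ) (_ : ℝ) => Real.log n.factorial / n - Real.log n) (fun _ => -1) atTop C :=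
    tendsto_log_factorial_div_sub_log.tendstoUniformlyOn_const C
  refine (((h1.sub h2).add h3).congr_right ?_).congr (Eventually.of_forall fun n x _ => rfl)
  intro x _
  simp only [Pi.add_apply, Pi.sub_apply]
  ring

theorem antitoneOn_forestPart {q : ℝ} (hq : 0 < q) {r : ℕ∞} (hr : 1 ≤ r) (b : ℝ) :
    ∀ᶠ n : ℕ in atTop, AntitoneOn (forestPart r q n) (Set.Ioc 0 b) := by
  filter_upwards [tendsto_natCast_atTop_atTop.eventually_gt_atTop b] with n hn x hx y hy hxy
  have hyn : 0 < (n : ℝ) - y := sub_pos.2 (hy.2.trans_lt hn)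
  have hy0 : 0 < y := hy.1
  have hx0 : 0 < x := hx.1
  have hN : 0 < q * (n - y) / y := by positivity
  refine div_le_div_of_nonneg_right (Real.log_le_log (forestCoeff_pos hr n hN)
    (forestCoeff_mono r n hN.le ?_)) (Nat.cast_nonneg n)
  have hxn : 0 < (n : ℝ) - x := by linarith
  gcongr

theorem tendsto_forestPart {q : ℝ} (hq : 0 < q) {r : ℕ∞} (hr : 1 ≤ r) {lam : ℝ} (hlam : 0 < lam) :
    Tendsto (fun n => forestPart r q n lam) atTop (𝓝 (forestRate r (q / lam))) := by
  have ht : 0 < q / lam := by positivity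
  have hmain := tendsto_logCoeff_div hr ht
  have hlog : Tendsto (fun n : ℕ => Real.log (1 - lam / n)) atTop (𝓝 0) := by
    have h2 : Tendsto (fun n : ℕ => lam / (n : ℝ)) atTop (𝓝 0) :=
      tendsto_const_nhds.div_atTop tendsto_natCast_atTop_atTop
    have := (h2.const_sub 1).log (by norm_num)
    simpa using this
  have hlow := hmain.add hlog
  rw [add_zero] at hlow
  refine tendsto_of_tendsto_of_tendsto_of_le_of_le' hlow hmain ?_ ?_
  all_goals
    filter_upwards [tendsto_natCast_atTop_atTop.eventually_gt_atTop lam] with n hn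
    have hn0 : (0 : ℝ) < n := hlam.trans hn
    have hnl : (0 : ℝ) < n - lam := sub_pos.2 hn
    have hN : 0 < q * (n - lam) / lam := by positivity
    have hNle : q * (n - lam) / lam ≤ q / lam * n := by
      rw [div_mul_eq_mul_div]
      gcongr
      linarith
  · have h1 := forestCoeff_le_pow_mul r n hN hNle
    have hp : 0 < 1 - lam / n := sub_pos.2 ((div_lt_one hn0).2 hn)
    have e1 : q / lam * n / (q * (n - lam) / lam) = (1 - lam / n)⁻¹ := by field_simp
    rw [e1] at h1
    have h2 := Real.log_le_log (forestCoeff_mul_pos hr n ht) h1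
    rw [Real.log_mul (by positivity) (forestCoeff_pos hr n hN).ne', Real.log_pow,
      Real.log_inv] at h2
    have h3 : logCoeff r (q / lam) n / n + Real.log (1 - lam / n) =
        (logCoeff r (q / lam) n + n * Real.log (1 - lam / n)) / n := by field_simp
    rw [h3, forestPart]
    gcongr
    rw [logCoeff]
    linarith
  · rw [forestPart, logCoeff]
    have := forestCoeff_pos hr n hN
    gcongr
    exact forestCoeff_mono r n hN.le hNle

theorem continuousOn_forestRate_div {q : ℝ} (hq : 0 < q) {r : ℕ∞} (hr : 1 ≤ r) :
    ContinuousOn (fun lam => forestRate r (q / lam)) (Set.Ioi 0) :=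
  (continuousOn_forestRate hr).comp
    (continuousOn_const.div continuousOn_id fun _ hx => ne_of_gt hx) fun _ hx => div_pos hq hx

/-- The exponential growth rate of `Z_{n,λ,q}[B_r ∩ L]`, and of `Z_{n,λ,q}[L]` for `r = ⊤`. -/
def boundedRate (q : ℝ) (r : ℕ∞) (lam : ℝ) : ℝ :=
  -(lam / 2) + Real.log lam - 1 + forestRate r (q / lam)

theorem tendstoUniformlyOn_log_Z {q : ℝ} (hq : 0 < q) {r : ℕ∞} (hr : 1 ≤ r) {C : Set ℝ}
    (hC : IsCompact C) (hC0 : C ⊆ Set.Ioi 0) {A : (n : ℕ) → Set (Config (K n))}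
    (hA : ∀ n, A n = {ω | IsBoundedForest r (openGraph (K n) ω)}) :
    TendstoUniformlyOn (fun (n : ℕ) lam => 1 / (n : ℝ) * Real.log (Z n lam q (A n)))
      (boundedRate q r) atTop C := by
  have h1 := (tendstoUniformlyOn_explicitPart hC hC0).add
    (tendstoUniformlyOn_of_antitoneOn hC hC0 (antitoneOn_forestPart hq hr)
      (fun _ => tendsto_forestPart hq hr) (continuousOn_forestRate_div hq hr))
  refine (h1.congr ?_).congr_right fun x _ => rfl
  obtain ⟨b, hb⟩ := hC.bddAbove
  filter_upwards [tendsto_natCast_atTop_atTop.eventually_gt_atTop b] with n hn lam hlam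
  exact (log_Z_eq hq hr (hC0 hlam) ((hb hlam).trans_lt hn) (hA n)).symm

theorem tendsto_log_Z {q : ℝ} (hq : 0 < q) {r : ℕ∞} (hr : 1 ≤ r) {lam : ℝ} (hlam : 0 < lam)
    {A : (n : ℕ) → Set (Config (K n))}
    (hA : ∀ n, A n = {ω | IsBoundedForest r (openGraph (K n) ω)}) :
    Tendsto (fun n : ℕ => 1 / (n : ℝ) * Real.log (Z n lam q (A n))) atTop
      (𝓝 (boundedRate q r lam)) :=
  (tendstoUniformlyOn_log_Z hq hr isCompact_singleton (Set.singleton_subset_iff.2 hlam)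
    hA).tendsto_at (Set.mem_singleton lam)

theorem tendsto_boundedRate {q : ℝ} (hq : 0 < q) {lam : ℝ} (hlam : 0 < lam) :
    Tendsto (fun r : ℕ => boundedRate q r lam) atTop (𝓝 (boundedRate q ⊤ lam)) :=
  (tendsto_forestRate_bound (div_pos hq hlam)).const_add _

theorem tendstoUniformlyOn_boundedRate {q : ℝ} (hq : 0 < q) {C : Set ℝ}
    (hC : IsCompact C) (hC0 : C ⊆ Set.Ioi 0) :
    TendstoUniformlyOn (fun r : ℕ => boundedRate q r) (boundedRate q ⊤) atTop C := by
  have h : TendstoUniformlyOn (fun (r : ℕ) lam => forestRate r (q / lam))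
      (fun lam => forestRate ⊤ (q / lam)) atTop C := by
    refine tendstoUniformlyOn_of_antitoneOn hC hC0 (fun b => ?_)
      (fun x hx => tendsto_forestRate_bound (div_pos hq hx)) (continuousOn_forestRate_div hq le_top)
    filter_upwards [eventually_ge_atTop 1] with r hr x hx y hy hxy
    have hx0 : 0 < x := hx.1
    exact forestRate_mono (by exact_mod_cast hr) (div_pos hq hy.1) (by gcongr)
  have h0 : TendstoUniformlyOn (fun (_ : ℕ) (lam : ℝ) => -(lam / 2) + Real.log lam - 1)
      (fun lam => -(lam / 2) + Real.log lam - 1) atTop C :=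
    fun u hu => Eventually.of_forall fun _ _ _ => refl_mem_uniformity hu
  exact h0.add h

/-! ### Identification of the limit -/

theorem log_le_half_sub_inv {x : ℝ} (hx : 1 ≤ x) : Real.log x ≤ 1 / 2 * (x - 1 / x) := by
  have hx0 : 0 < x := by linarith
  have h := Real.self_le_sinh_iff.2 (Real.log_nonneg hx)
  rw [Real.sinh_eq, Real.exp_neg, Real.exp_log hx0] at h
  rw [one_div x]
  linarith

theorem boundedRate_top {q lam : ℝ} (hq : 0 < q) (hlam : 0 < lam) :
    boundedRate q ⊤ lam = acyclicRate q lam := by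
  rw [boundedRate, acyclicRate, Psi]
  rcases le_total lam q with h | h
  · have h1 : 1 ≤ q / lam := (one_le_div hlam).2 h
    have h2 := log_le_half_sub_inv h1
    have h3 : Real.log (lam / q) = -Real.log (q / lam) := by rw [← Real.log_inv, inv_div]
    have e : 1 / (lam / q) = q / lam := one_div_div _ _
    have e' : 1 / (q / lam) = lam / q := one_div_div _ _
    rw [e'] at h2
    rw [forestRate_top_of_one_le h1, min_eq_right (by rw [h3, e]; linarith),
      Real.log_div hq.ne' hlam.ne']
    field_simp
    ring
  · have h1 : 1 ≤ lam / q := (one_le_div hq).2 h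
    have h2 := log_le_half_sub_inv h1
    rw [forestRate_top_of_le_one (div_pos hq hlam) ((div_le_one hlam).2 h),
      min_eq_left (by linarith), Real.log_div hlam.ne' hq.ne']
    field_simp
    ring

end RandomCluster

end

theorem mainTheorem5 (q : ℝ) (hq : 0 < q) :
    ∃ g : ℕ → ℝ → ℝ,
      (∀ lam : ℝ, 0 < lam →
        Tendsto (fun n : ℕ => 1 / (n : ℝ) * Real.log (RandomCluster.Z n lam q (RandomCluster.L n)))
          atTop (𝓝 (RandomCluster.acyclicRate q lam)) ∧
        (∀ r : ℕ, 1 ≤ r →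
          Tendsto (fun n : ℕ => 1 / (n : ℝ) *
              Real.log (RandomCluster.Z n lam q (RandomCluster.B n r ∩ RandomCluster.L n)))
            atTop (𝓝 (g r lam))) ∧
        Tendsto (fun r : ℕ => g r lam) atTop (𝓝 (RandomCluster.acyclicRate q lam))) ∧
      (∀ C : Set ℝ, IsCompact C → C ⊆ Set.Ioi 0 \ {q} →
        TendstoUniformlyOn
          (fun (n : ℕ) (lam : ℝ) =>
            1 / (n : ℝ) * Real.log (RandomCluster.Z n lam q (RandomCluster.L n)))
          (RandomCluster.acyclicRate q) atTop C ∧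
        (∀ r : ℕ, 1 ≤ r →
          TendstoUniformlyOn
            (fun (n : ℕ) (lam : ℝ) => 1 / (n : ℝ) *
              Real.log (RandomCluster.Z n lam q (RandomCluster.B n r ∩ RandomCluster.L n)))
            (g r) atTop C) ∧
        TendstoUniformlyOn g (RandomCluster.acyclicRate q) atTop C) := by
  refine ⟨fun r => RandomCluster.boundedRate q r, fun lam hlam => ⟨?_, fun r hr => ?_, ?_⟩,
    fun C hC hCq => ?_⟩
  · rw [← RandomCluster.boundedRate_top hq hlam]
    exact RandomCluster.tendsto_log_Z hq le_top hlam RandomCluster.L_eq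
  · exact RandomCluster.tendsto_log_Z hq (by exact_mod_cast hr) hlam
      fun n => RandomCluster.B_inter_L_eq n r
  · rw [← RandomCluster.boundedRate_top hq hlam]
    exact RandomCluster.tendsto_boundedRate hq hlam
  · have hC0 : C ⊆ Set.Ioi 0 := fun x hx => (hCq hx).1
    have htop : Set.EqOn (RandomCluster.boundedRate q ⊤) (RandomCluster.acyclicRate q) C :=
      fun x hx => RandomCluster.boundedRate_top hq (hC0 hx)
    refine ⟨?_, fun r hr => ?_, ?_⟩
    · exact (RandomCluster.tendstoUniformlyOn_log_Z hq le_top hC hC0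
        RandomCluster.L_eq).congr_right htop
    · exact RandomCluster.tendstoUniformlyOn_log_Z hq (by exact_mod_cast hr) hC hC0
        fun n => RandomCluster.B_inter_L_eq n r
    · exact (RandomCluster.tendstoUniformlyOn_boundedRate hq hC hC0).congr_right htop
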